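/- **Setting.** Let $P,X,Y,E$ be finite-dimensional Euclidean spaces, with duals $P^*,X^*,Y^*,E^*$. For a set $\Omega$ and $z\in\Omega$, let $T_\Omega(z)$ be the contingent (Bouligand) tangent cone, and let $N_\Omega(z)$ be the limiting (Mordukhovich) normal cone, i.e. the set of all limits of regular (Fréchet) normals $\zeta_k\in\widehat N_\Omega(z_k)$ with $z_k\to z$, $z_k\in\Omega$; put $N_\Omega(z)=\emptyset$ for $z\notin\Omega$. Let $\mathcal K_\Omega(z,\zeta)=T_\Omega(z)\cap\{\zeta\}^\perp$ be the critical cone. Let $C\subset Y$ be closed, $g\colon P\times X\to Y$, $f\colon P\times X\to X^*$, $\Gamma(p)=\{x\in X: g(p,x)\in C\}$, and $$S(p)=\{x\in X:\ 0\in f(p,x)+N_{\Gamma(p)}(x)\}.$$ Fix $\bar z=(\bar p,\bar x)$ with $\bar x\in S(\bar p)$. Assume that $g$ is $C^2$ around $\bar z$, that $f$ is $C^1$ around $\bar z$, and that $C$ is $C^2$-reducible at $\bar y=g(\bar z)$ to a closed convex cone $K\subset E$: there are an open neighborhood $V$ of $\bar y$ and a $C^2$ mapping $h\colon V\to E$ with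 $h(\bar y)=0$, $\nabla h(\bar y)$ surjective and $C\cap V=\{y\in V: h(y)\in K\}$. For $\lambda\in N_C(\bar y)$ let $\mu_\lambda=(\nabla h(\bar y)^*)^{-1}\lambda\in E^*$ be the unique functional with $\nabla h(\bar y)^*\mu_\lambda=\lambda$. Define - $\bar\Lambda=\{\lambda\in N_C(\bar y): f(\bar z)+\nabla_xg(\bar z)^*\lambda=0\}$ and $\Lambda(\bar z,z^*)=\{\lambda\in N_C(\bar y):\nabla g(\bar z)^*\lambda=z^*\}$; - $\Lambda(\bar z,z^*;v)=\arg\max\{\langle\lambda,\nabla^2g(\bar z)(v,v)\rangle+\nabla^2\langle\mu_\lambda,h(\cdot)\rangle(\bar y)(\nabla g(\bar z)v,\nabla g(\bar z)v):\lambda\in\Lambda(\bar z,z^*)\}$; - $\mathcal F_\lambda u=\nabla_xf(\bar z)u+\nabla_x^2\langle\lambda,g(\cdot)\rangle(\bar z)u+\nabla_xg(\bar z)^*\,\nabla^2\langle\mu_\lambda,h(\cdot)\rangle(\bar y)\,\nabla_xg(\bar z)u$ for $u\in X$; - $\mathcal P=\{q\in P:\nabla_pG(\bar z)q\in\operatorname{rge}\nabla_xG(\bar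 z)+\operatorname{lin}K\}$, where $G=h\circ g$ near $\bar z$ and $\operatorname{lin}K=K\cap(-K)$. **Theorem (Hölderian isolated calmness).** Assume that the system $g(p,x)\in C$ is Robinson stable at $(\bar p,\bar x)$, i.e. there are $\kappa\ge0$ and neighborhoods $W$ of $\bar p$ and $U_0$ of $\bar x$ such that $\operatorname{dist}(x;\Gamma(p))\le\kappa\operatorname{dist}(g(p,x);C)$ for all $(p,x)\in W\times U_0$ (with $\operatorname{dist}(x;\emptyset)=\infty$). Assume further that for every $0\ne u\in\mathcal K_{\Gamma(\bar p)}(\bar x,-f(\bar z))$, every $\lambda\in\bar\Lambda$ and every $\hat\lambda\in\Lambda(\bar z,\nabla g(\bar z)^*\lambda;(0,u))$, either $\langle\mathcal F_{\hat\lambda}u,u\rangle>0$, or $\langle\mathcal F_{\hat\lambda}u,\tilde u\rangle<0$ for some $\tilde u\in\mathcal K_{\Gamma(\bar p)}(\bar x,-f(\bar z))$. Then there are $\ell>0$ and neighborhoods $U$ of $\bar x$ and $Q$ of $\bar p$ such that, with $\mathbb B$ the closed unit ball of $X$, $$S(p)\cap U\subset\{\bar x\}+\ell\Big(\|p-\bar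 p\|+\sqrt{\operatorname{dist}(p-\bar p;\mathcal P)}\Big)\mathbb B\qquad\text{for all }p\in Q,$$ and such that moreover, for every $\gamma>0$ and $\mathcal P_\gamma=\{p\in P:\operatorname{dist}(p-\bar p;\mathcal P)\le\gamma\|p-\bar p\|^2\}$, $$S(p)\cap U\subset\{\bar x\}+(\ell+\gamma)\|p-\bar p\|\,\mathbb B\qquad\text{for all }p\in Q\cap\mathcal P_\gamma.$$ Consequently, for every $\gamma>0$ the restriction of $S$ to $\mathcal P_\gamma$ is isolatedly calm at $(\bar p,\bar x)$: there are $\ell'>0$ and neighborhoods $Q'$ of $\bar p$ and $U'$ of $\bar x$ with $S(p)\cap U'\subset\{\bar x\}+\ell'\|p-\bar p\|\mathbb B$ for all $p\in Q'\cap\mathcal P_\gamma$. -/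

import Mathlib

open Set Filter Topology
open scoped NNReal ENNReal

noncomputable section

namespace PVS

/-! ### Normal, tangent and critical cones -/

section Cones

variable {Z : Type*} [NormedAddCommGroup Z] [NormedSpace ℝ Z]

/-- The regular (Fréchet) normal cone to `Ω` at `z`: all `ζ ∈ Z*` such that the upper limit of
`⟨ζ, w - z⟩ / ‖w - z‖` as `w → z`, `w ∈ Ω`, is at most `0`. It is empty if `z ∉ Ω`. -/
def regularNormalCone (Ω : Set Z) (z : Z) : Set (StrongDual ℝ Z) :=
  {ζ | z ∈ Ω ∧ ∀ ε : ℝ, 0 < ε → ∀ᶠ w in 𝓝[Ω] z, ζ (w - z) ≤ ε * ‖w - z‖}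

/-- The limiting (Mordukhovich) normal cone `N_Ω(z)`. It is empty if `z ∉ Ω`. -/
def normalCone (Ω : Set Z) (z : Z) : Set (StrongDual ℝ Z) :=
  {ζ | z ∈ Ω ∧ ∃ (w : ℕ → Z) (η : ℕ → StrongDual ℝ Z),
    Tendsto w atTop (𝓝 z) ∧ Tendsto η atTop (𝓝 ζ) ∧ ∀ k, η k ∈ regularNormalCone Ω (w k)}

/-- The tangent (contingent, Bouligand–Severi) cone `T_Ω(z)`. -/
def tangentCone (Ω : Set Z) (z : Z) : Set Z :=
  {v | ∃ (t : ℕ → ℝ) (w : ℕ → Z), (∀ k, 0 < t k) ∧ Tendsto t atTop (𝓝 0) ∧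
    Tendsto w atTop (𝓝 v) ∧ ∀ k, z + t k • w k ∈ Ω}

/-- The critical cone `K_Ω(z, ζ) = T_Ω(z) ∩ {ζ}^⊥`. -/
def criticalCone (Ω : Set Z) (z : Z) (ζ : StrongDual ℝ Z) : Set Z :=
  {v | v ∈ tangentCone Ω z ∧ ζ v = 0}

/-- The second derivative `∇²φ(z)` as a bilinear map. -/
def secondDeriv {W : Type*} [NormedAddCommGroup W] [NormedSpace ℝ W] (φ : Z → W) (z : Z) :
    Z →L[ℝ] Z →L[ℝ] W :=
  fderiv ℝ (fderiv ℝ φ) z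

end Cones

variable {P X Y E : Type*}
  [NormedAddCommGroup P] [InnerProductSpace ℝ P]
  [NormedAddCommGroup X] [InnerProductSpace ℝ X]
  [NormedAddCommGroup Y] [InnerProductSpace ℝ Y]
  [NormedAddCommGroup E] [InnerProductSpace ℝ E]

/-! ### Parametric constraint systems -/

/-- `C` is `C²`-reducible at `y` to the closed convex cone `K` by means of the mapping `h`, which
is only relevant on a neighborhood `V` of `y`. -/
def IsC2ConeReduction (C : Set Y) (y : Y) (h : Y → E) (K : ProperCone ℝ E) : Prop :=
  ∃ V : Set Y, IsOpen V ∧ y ∈ V ∧ ContDiffOn ℝ 2 h V ∧ h y = 0 ∧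
    Function.Surjective (fderiv ℝ h y) ∧ C ∩ V = {v | v ∈ V ∧ h v ∈ K}

/-- The feasible set `Γ(p) = {x | g(p,x) ∈ C}`. -/
def feasibleSet (g : P × X → Y) (C : Set Y) (p : P) : Set X :=
  {x | g (p, x) ∈ C}

/-- Robinson stability of `g(p,x) ∈ C` at `(p₀,x₀)`. Distances take values in `[0,∞]`, so that
the distance to an empty set is `∞`. -/
def RobinsonStable (g : P × X → Y) (C : Set Y) (p₀ : P) (x₀ : X) : Prop :=
  ∃ κ : ℝ≥0, ∃ W ∈ 𝓝 p₀, ∃ U ∈ 𝓝 x₀, ∀ p ∈ W, ∀ x ∈ U,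
    Metric.infEDist x (feasibleSet g C p) ≤ κ * Metric.infEDist (g (p, x)) C

/-- The partial derivative `∇ₓφ(p₀,x₀)`. -/
def partialX {W : Type*} [NormedAddCommGroup W] [NormedSpace ℝ W] (φ : P × X → W)
    (p₀ : P) (x₀ : X) : X →L[ℝ] W :=
  fderiv ℝ (fun x => φ (p₀, x)) x₀

/-- The partial derivative `∇ₚφ(p₀,x₀)`. -/
def partialP {W : Type*} [NormedAddCommGroup W] [NormedSpace ℝ W] (φ : P × X → W)
    (p₀ : P) (x₀ : X) : P →L[ℝ] W :=
  fderiv ℝ (fun p => φ (p, x₀)) p₀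

/-- The characteristic subspace of the parameter space: all `q` with
`∇ₚG(p₀,x₀)q ∈ rge ∇ₓG(p₀,x₀) + lin K`, where `G = h ∘ g` and `lin K = K ∩ (-K)`. -/
def characteristicSubspace (g : P × X → Y) (h : Y → E) (K : ProperCone ℝ E)
    (p₀ : P) (x₀ : X) : Set P :=
  {q | ∃ u : X, ∃ e : E, e ∈ K ∧ -e ∈ K ∧
    partialP (h ∘ g) p₀ x₀ q = partialX (h ∘ g) p₀ x₀ u + e}

/-! ### Multipliers -/

/-- `(∇h(y)*)⁻¹ lam`: the functional `μ ∈ E*` with `∇h(y)* μ = lam`. It is unique when `∇h(y)` is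
surjective, and it exists for all `lam ∈ N_C(y)` when `h` reduces `C` at `y` to a convex cone. -/
def reducedMultiplier (h : Y → E) (y : Y) (lam : StrongDual ℝ Y) : StrongDual ℝ E :=
  Function.invFun (fun μ : StrongDual ℝ E => μ.comp (fderiv ℝ h y)) lam

/-- The bilinear form `∇²⟨(∇h(y)*)⁻¹ lam, h(·)⟩(y)` on `Y`. -/
def curvatureForm (h : Y → E) (y : Y) (lam : StrongDual ℝ Y) : Y →L[ℝ] Y →L[ℝ] ℝ :=
  secondDeriv (fun v => reducedMultiplier h y lam (h v)) y

/-- The multiplier set `Λ(z₀, ζ) = {lam ∈ N_C(g(z₀)) | ∇g(z₀)* lam = ζ}`. -/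
def multiplierSet (g : P × X → Y) (C : Set Y) (z₀ : P × X) (ζ : StrongDual ℝ (P × X)) :
    Set (StrongDual ℝ Y) :=
  {lam | lam ∈ normalCone C (g z₀) ∧ lam.comp (fderiv ℝ g z₀) = ζ}

/-- The objective `⟨lam, ∇²g(z₀)(v,v)⟩ + ∇²⟨(∇h(g(z₀))*)⁻¹ lam, h(·)⟩(g(z₀))(∇g(z₀)v, ∇g(z₀)v)`
whose maximizers over `Λ(z₀, ζ)` are the multipliers in direction `v`. -/
def directionalObjective (g : P × X → Y) (h : Y → E) (z₀ v : P × X) (lam : StrongDual ℝ Y) : ℝ :=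
  lam (secondDeriv g z₀ v v) +
    curvatureForm h (g z₀) lam (fderiv ℝ g z₀ v) (fderiv ℝ g z₀ v)

/-- The directional multiplier set `Λ(z₀, ζ; v)`. -/
def directionalMultiplierSet (g : P × X → Y) (C : Set Y) (h : Y → E) (z₀ : P × X)
    (ζ : StrongDual ℝ (P × X)) (v : P × X) : Set (StrongDual ℝ Y) :=
  {lam | lam ∈ multiplierSet g C z₀ ζ ∧
    IsMaxOn (directionalObjective g h z₀ v) (multiplierSet g C z₀ ζ) lam}

/-! ### Parametric variational systems -/

/-- The solution map `S(p) = {x | 0 ∈ f(p,x) + N_{Γ(p)}(x)}`. -/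
def solutionMap (f : P × X → StrongDual ℝ X) (g : P × X → Y) (C : Set Y) (p : P) : Set X :=
  {x | -f (p, x) ∈ normalCone (feasibleSet g C p) x}

/-- The multiplier set `{lam ∈ N_C(g(p₀,x₀)) | f(p₀,x₀) + ∇ₓg(p₀,x₀)* lam = 0}`. -/
def pvsMultiplierSet (f : P × X → StrongDual ℝ X) (g : P × X → Y) (C : Set Y)
    (p₀ : P) (x₀ : X) : Set (StrongDual ℝ Y) :=
  {lam | lam ∈ normalCone C (g (p₀, x₀)) ∧ f (p₀, x₀) + lam.comp (partialX g p₀ x₀) = 0}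

/-- The curvature operator `u ↦ ∇ₓg* ∇²⟨(∇h(g)*)⁻¹ lam, h(·)⟩(g) ∇ₓg u`, all at `(p₀,x₀)`. -/
def curvatureOp (g : P × X → Y) (h : Y → E) (p₀ : P) (x₀ : X) (lam : StrongDual ℝ Y) (u : X) :
    StrongDual ℝ X :=
  (curvatureForm h (g (p₀, x₀)) lam (partialX g p₀ x₀ u)).comp (partialX g p₀ x₀)

/-- The operator `F_lam u = ∇ₓf u + ∇ₓ²⟨lam, g(·)⟩ u + H_lam u`, all at `(p₀,x₀)`, where `H_lam` is
the curvature operator. -/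
def operatorF (f : P × X → StrongDual ℝ X) (g : P × X → Y) (h : Y → E) (p₀ : P) (x₀ : X)
    (lam : StrongDual ℝ Y) (u : X) : StrongDual ℝ X :=
  partialX f p₀ x₀ u + secondDeriv (fun x => lam (g (p₀, x))) x₀ u + curvatureOp g h p₀ x₀ lam u

/-- The second-order condition over critical directions `u` and directional multipliers `lam'`.
For critical `u` and `lam` in the multiplier set, `(0,u)` is automatically a critical direction of
the graph of `Γ` for `∇g(p₀,x₀)* lam`. -/
def SecondOrderCondition (f : P × X → StrongDual ℝ X) (g : P × X → Y) (C : Set Y) (h : Y → E)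
    (p₀ : P) (x₀ : X) : Prop :=
  ∀ u ∈ criticalCone (feasibleSet g C p₀) x₀ (-f (p₀, x₀)), u ≠ 0 →
    ∀ lam ∈ pvsMultiplierSet f g C p₀ x₀,
      ∀ lam' ∈ directionalMultiplierSet g C h (p₀, x₀)
        (lam.comp (fderiv ℝ g (p₀, x₀))) ((0 : P), u),
        0 < operatorF f g h p₀ x₀ lam' u u ∨
          ∃ u' ∈ criticalCone (feasibleSet g C p₀) x₀ (-f (p₀, x₀)),
            operatorF f g h p₀ x₀ lam' u u' < 0

/-- Isolated calmness at `(p₀,x₀)` of the restriction of `S` to the parameter set `A`. -/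
def IsolatedlyCalmOn (S : P → Set X) (A : Set P) (p₀ : P) (x₀ : X) : Prop :=
  ∃ l : ℝ, 0 < l ∧ ∃ Q ∈ 𝓝 p₀, ∃ U ∈ 𝓝 x₀, ∀ p ∈ Q ∩ A,
    S p ∩ U ⊆ Metric.closedBall x₀ (l * ‖p - p₀‖)

/-- The parameters `p` with `dist(p - p₀; L) ≤ γ ‖p - p₀‖²`. -/
def nearSubspace (L : Set P) (p₀ : P) (γ : ℝ) : Set P :=
  {p | Metric.infDist (p - p₀) L ≤ γ * ‖p - p₀‖ ^ 2}

end PVS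

end

/-! The estimate is proved by contradiction. If it fails for every constant, there are solutions `z
k = (p, x)` tending to `(p₀, x₀)` for which `t k = ‖x - x₀‖` exceeds `k + 1` times the right-hand
side. Rescaled by `t k`, the displacement subconverges to `(0, u₀)` with `‖u₀‖ = 1`, and `p - p₀`
lies in the characteristic subspace up to an error `t k ^ 2 • r k` with `r k → 0`.

Put `G = h ∘ g`. Robinson stability and the surjectivity of `∇h` give a linear error bound for `G ∈
K`, and Hahn–Banach turns it into multipliers `μ k` in the polar of `K`, complementary to `G (z k)`
and bounded by a multiple of `‖f (z k)‖`; along a subsequence `μ k → μ₀`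
(`exists_multiplier_of_mem_normalCone`, `eventually_exists_multiplier`).

Let `L` be the derivative of `f + (∇ₓG)* μ₀`, with `μ₀` fixed, in direction `(0, u₀)`. For each
multiplier `ν` at the reference point, `(ν - μ k) ∘ ∇ₓG / t k` tends to `L`. Two consequences carry
the proof. Taking `ν = μ₀` on critical directions gives `L ≥ 0` there (`lagrangianDeriv_nonneg`).
Expanding `(ν - μ k)(G (z k)) ≤ 0` to second order gives `L u₀ + (ν - μ₀)(∇²G(u₀, u₀)) / 2 ≤ 0`
(`lagrangianDeriv_add_le`); closeness to the characteristic subspace is what removes the first-order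
parameter term. Since `u₀` is critical, these show that `μ₀` yields a directional multiplier, that
`L u₀ ≤ 0`, and that `L` is nowhere negative on the critical cone, contrary to the second-order
condition (`SecondOrderCondition.false_of_tendsto`). -/

namespace PVS

/-! ### Multipliers for normals from a linear error bound. -/

section Multipliers

variable {Z E : Type*} [NormedAddCommGroup Z] [NormedSpace ℝ Z]
  [NormedAddCommGroup E] [NormedSpace ℝ E]

theorem tendsto_clm_apply {ι W : Type*} [NormedAddCommGroup W] [NormedSpace ℝ W] {l : Filter ι}
    {T : ι → Z →L[ℝ] W} {T₀ : Z →L[ℝ] W} {v : ι → Z} {v₀ : Z} (hT : Tendsto T l (𝓝 T₀))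
    (hv : Tendsto v l (𝓝 v₀)) : Tendsto (fun i => T i (v i)) l (𝓝 (T₀ v₀)) :=
  (isBoundedBilinearMap_apply (𝕜 := ℝ).continuous.tendsto (T₀, v₀)).comp (hT.prodMk_nhds hv)

theorem tendsto_clm_comp {ι W : Type*} [NormedAddCommGroup W] [NormedSpace ℝ W] {l : Filter ι}
    {T : ι → E →L[ℝ] W} {T₀ : E →L[ℝ] W} {A : ι → Z →L[ℝ] E} {A₀ : Z →L[ℝ] E}
    (hT : Tendsto T l (𝓝 T₀)) (hA : Tendsto A l (𝓝 A₀)) :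
    Tendsto (fun i => (T i).comp (A i)) l (𝓝 (T₀.comp A₀)) :=
  (isBoundedBilinearMap_comp (𝕜 := ℝ).continuous.tendsto (T₀, A₀)).comp (hT.prodMk_nhds hA)

theorem properCone_smul_mem (K : ProperCone ℝ E) {c : ℝ} (hc : 0 ≤ c) {w : E} (hw : w ∈ K) :
    c • w ∈ K :=
  K.toSubmodule.smul_mem (⟨c, hc⟩ : {r : ℝ // 0 ≤ r}) hw

theorem infDist_pointedCone_add_le (T : PointedCone ℝ E) (a b : E) :
    Metric.infDist (a + b) (T : Set E) ≤ Metric.infDist a T + Metric.infDist b T := by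
  have hne : (T : Set E).Nonempty := ⟨0, T.zero_mem⟩
  refine le_of_forall_pos_le_add fun ε hε => ?_
  obtain ⟨s, hs, has⟩ := (Metric.infDist_lt_iff hne).1
    (lt_add_of_pos_right (Metric.infDist a (T : Set E)) (half_pos hε))
  obtain ⟨r, hr, hbr⟩ := (Metric.infDist_lt_iff hne).1
    (lt_add_of_pos_right (Metric.infDist b (T : Set E)) (half_pos hε))
  have h1 : Metric.infDist (a + b) (T : Set E) ≤ dist (a + b) (s + r) :=
    Metric.infDist_le_dist_of_mem (T.add_mem hs hr)
  have h2 := dist_add_add_le a b s r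
  linarith

theorem infDist_pointedCone_smul_le (T : PointedCone ℝ E) {c : ℝ} (hc : 0 < c) (a : E) :
    Metric.infDist (c • a) (T : Set E) ≤ c * Metric.infDist a T := by
  have hne : (T : Set E).Nonempty := ⟨0, T.zero_mem⟩
  rw [← div_le_iff₀' hc]
  refine (Metric.le_infDist hne).2 fun s hs => ?_
  rw [div_le_iff₀' hc]
  have hcs : c • s ∈ T := T.smul_mem hc.le hs
  refine (Metric.infDist_le_dist_of_mem hcs).trans ?_
  rw [dist_smul₀, Real.norm_of_nonneg hc.le]

theorem infDist_pointedCone_smul (T : PointedCone ℝ E) {c : ℝ} (hc : 0 < c) (a : E) :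
    Metric.infDist (c • a) (T : Set E) = c * Metric.infDist a T := by
  refine le_antisymm (infDist_pointedCone_smul_le T hc a) ?_
  have h := infDist_pointedCone_smul_le T (inv_pos.2 hc) (c • a)
  rwa [smul_smul, inv_mul_cancel₀ hc.ne', one_smul, le_inv_mul_iff₀ hc] at h

/-- A functional dominated by a multiple of the distance to a convex cone after a linear map
factors through a functional in the polar of this cone, with control of the norm. -/
theorem exists_dual_comp_eq_of_le_dist (A : Z →L[ℝ] E) (ζ : StrongDual ℝ Z)
    (T : PointedCone ℝ E) {M : ℝ} (hM : 0 ≤ M) (hζ : ∀ u, ∀ s ∈ T, ζ u ≤ M * ‖A u - s‖) :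
    ∃ μ : StrongDual ℝ E, μ.comp A = ζ ∧ (∀ s ∈ T, μ s ≤ 0) ∧ ‖μ‖ ≤ M := by
  have hne : (T : Set E).Nonempty := ⟨0, T.zero_mem⟩
  have hker : LinearMap.ker (A : Z →ₗ[ℝ] E) ≤ LinearMap.ker (ζ : Z →ₗ[ℝ] ℝ) := by
    intro u hu
    have hu' : A u = 0 := hu
    have h1 := hζ u 0 T.zero_mem
    have h2 := hζ (-u) 0 T.zero_mem
    simp only [map_neg, hu', neg_zero, sub_zero, norm_zero, mul_zero] at h1 h2
    exact le_antisymm (a := ζ u) h1 (by linarith)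
  -- The kernel inclusion gives an algebraic factorization. Only its restriction to `rge A` is kept;
  -- Hahn–Banach extends it below the sublinear function `M * infDist · T`, which controls the norm
  -- and vanishes on `T`, forcing polarity.
  obtain ⟨φ, hφ⟩ : ∃ φ : E →ₗ[ℝ] ℝ, φ ∘ₗ (A : Z →ₗ[ℝ] E) = ζ := by
    have : (ζ : Z →ₗ[ℝ] ℝ) ∈ LinearMap.range (A : Z →ₗ[ℝ] E).dualMap := by
      rw [LinearMap.range_dualMap_eq_dualAnnihilator_ker, Submodule.mem_dualAnnihilator]
      exact fun u hu => hker hu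
    obtain ⟨φ, hφ⟩ := this
    exact ⟨φ, hφ⟩
  have hφA : ∀ u, φ (A u) = ζ u := fun u => LinearMap.congr_fun hφ u
  obtain ⟨ψ, hψ, hψN⟩ := exists_extension_of_le_sublinear
    ⟨LinearMap.range (A : Z →ₗ[ℝ] E), φ.domRestrict _⟩
    (fun e => M * Metric.infDist e (T : Set E))
    (fun c hc e => by rw [infDist_pointedCone_smul T hc]; ring)
    (fun a b => by
      rw [← mul_add]; exact mul_le_mul_of_nonneg_left (infDist_pointedCone_add_le T a b) hM)
    (by
      rintro ⟨_, u, rfl⟩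
      change φ (A u) ≤ M * Metric.infDist (A u) (T : Set E)
      rw [hφA]
      rcases hM.eq_or_lt with rfl | hM
      · simpa using hζ u 0 T.zero_mem
      · rw [← div_le_iff₀' hM]
        refine (Metric.le_infDist hne).2 fun s hs => ?_
        rw [div_le_iff₀' hM, dist_eq_norm]
        exact hζ u s hs)
  have hle : ∀ e, ψ e ≤ M * ‖e‖ := fun e => (hψN e).trans <| by
    refine mul_le_mul_of_nonneg_left ?_ hM
    simpa using Metric.infDist_le_dist_of_mem (x := e) T.zero_mem
  have hbound : ∀ e, ‖ψ e‖ ≤ M * ‖e‖ := fun e => by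
    rw [Real.norm_eq_abs, abs_le]
    have := hle (-e)
    rw [map_neg, norm_neg] at this
    exact ⟨by linarith, hle e⟩
  refine ⟨ψ.mkContinuous M hbound, ?_, fun s hs => ?_, ψ.mkContinuous_norm_le hM hbound⟩
  · ext u
    exact (hψ ⟨A u, u, rfl⟩).trans (hφA u)
  · refine (hψN s).trans (le_of_eq ?_)
    rw [Metric.infDist_zero_of_mem hs, mul_zero]

/-- Multipliers for regular normals to a set described by a cone constraint that satisfies a
linear error bound. -/
theorem exists_multiplier_of_mem_regularNormalCone {Φ : Z → E} {A : Z →L[ℝ] E}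
    {K : ProperCone ℝ E} {Ω : Set Z} {z : Z} {κ : ℝ} (hκ : 0 ≤ κ) (hΦ : HasFDerivAt Φ A z)
    (hzK : Φ z ∈ K)
    (hbd : ∀ᶠ z' in 𝓝 z, ∀ w ∈ K, ∃ z'' ∈ Ω, ‖z' - z''‖ ≤ κ * ‖Φ z' - w‖)
    {ζ : StrongDual ℝ Z} (hζ : ζ ∈ regularNormalCone Ω z) :
    ∃ μ : StrongDual ℝ E, μ.comp A = ζ ∧ (∀ w ∈ K, μ w ≤ 0) ∧ μ (Φ z) = 0 ∧
      ‖μ‖ ≤ κ * ‖ζ‖ := by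
  -- Move from `z` to `z + t • u` and project to `Ω` by the error bound, using the nearby point `Φ z
  -- + t • (w - c • Φ z)` of `K`; then apply regularity of `ζ` and let `t`, then `ε`, tend to zero.
  have key : ∀ u, ∀ w ∈ K, ∀ c : ℝ, 0 ≤ c →
      ζ u ≤ κ * ‖ζ‖ * ‖A u - (w - c • Φ z)‖ := by
    intro u w hw c hc
    set d := ‖A u - (w - c • Φ z)‖ with hd
    have hε : ∀ ε : ℝ, 0 < ε → ζ u ≤ ε * (‖u‖ + κ * (d + ε)) + ‖ζ‖ * (κ * (d + ε)) := by
      intro ε hε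
      obtain ⟨-, hreg⟩ := hζ
      have hreg' := eventually_nhdsWithin_iff.1 (hreg ε hε)
      obtain ⟨δ, hδ, hδreg⟩ := Metric.eventually_nhds_iff.1 hreg'
      have hpath : Tendsto (fun t : ℝ => z + t • u) (𝓝[>] 0) (𝓝 z) := by
        have : Continuous fun t : ℝ => z + t • u := by fun_prop
        exact tendsto_nhdsWithin_of_tendsto_nhds (by simpa using this.tendsto 0)
      have hlin : Tendsto (fun t : ℝ => t⁻¹ • (Φ (z + t • u) - Φ z)) (𝓝[>] 0) (𝓝 (A u)) := by
        refine (hasFDerivWithinAt_univ.2 hΦ).lim (d := fun t : ℝ => t • u) ?_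
          (.of_forall fun _ => mem_univ _) ?_
        · have : Continuous fun t : ℝ => t • u := by fun_prop
          exact tendsto_nhdsWithin_of_tendsto_nhds (by simpa using this.tendsto 0)
        · refine tendsto_const_nhds.congr' ?_
          filter_upwards [self_mem_nhdsWithin] with t ht
          rw [smul_smul, inv_mul_cancel₀ (ne_of_gt ht), one_smul]
      have hdist : ∀ᶠ t : ℝ in 𝓝[>] 0,
          ‖t⁻¹ • (Φ (z + t • u) - Φ z) - (w - c • Φ z)‖ < d + ε :=
        ((hlin.sub_const (w - c • Φ z)).norm).eventually_lt_const (by linarith)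
      have hsmall : ∀ a b : ℝ, 0 < b → ∀ᶠ t : ℝ in 𝓝[>] 0, t * a < b := by
        intro a b hb
        have : Tendsto (fun t : ℝ => t * a) (𝓝 0) (𝓝 0) := by
          have : Continuous fun t : ℝ => t * a := by fun_prop
          simpa using this.tendsto 0
        exact (tendsto_nhdsWithin_of_tendsto_nhds this).eventually_lt_const hb
      obtain ⟨t, ht, hbdt, hdt, htc, htδ⟩ := ((eventually_mem_nhdsWithin (a := (0 : ℝ)) (s := Ioi 0)).and
        ((hpath.eventually hbd).and (hdist.and ((hsmall c 1 one_pos).and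
          (hsmall (‖u‖ + κ * (d + ε)) δ hδ))))).exists
      have ht : 0 < t := ht
      -- Membership holds because `t * c < 1` makes this a conic combination of `Φ z` and `w`.
      have hwt : Φ z + t • (w - c • Φ z) ∈ K := by
        have h1 : (1 - t * c) • Φ z ∈ K := properCone_smul_mem K (by linarith) hzK
        have h2 : t • w ∈ K := properCone_smul_mem K ht.le hw
        have h3 : Φ z + t • (w - c • Φ z) = (1 - t * c) • Φ z + t • w := by module
        exact h3 ▸ add_mem h1 h2
      obtain ⟨z'', hz'', hzz⟩ := hbdt _ hwt
      have hzz' : ‖z + t • u - z''‖ ≤ κ * (t * (d + ε)) := by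
        refine hzz.trans (mul_le_mul_of_nonneg_left ?_ hκ)
        have : Φ (z + t • u) - (Φ z + t • (w - c • Φ z)) =
            t • (t⁻¹ • (Φ (z + t • u) - Φ z) - (w - c • Φ z)) := by
          rw [smul_sub t (t⁻¹ • _), smul_smul, mul_inv_cancel₀ ht.ne', one_smul]; abel
        rw [this, norm_smul, Real.norm_of_nonneg ht.le]
        exact mul_le_mul_of_nonneg_left hdt.le ht.le
      have hz''z : ‖z'' - z‖ ≤ t * (‖u‖ + κ * (d + ε)) := by
        have h1 : z'' - z = t • u - (z + t • u - z'') := by abel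
        have h2 := norm_sub_le (t • u) (z + t • u - z'')
        rw [norm_smul, Real.norm_of_nonneg ht.le, ← h1] at h2
        linarith
      have hζ1 := hδreg (y := z'') (by rw [dist_eq_norm]; linarith) hz''
      have hζ2 : ζ (z + t • u - z'') ≤ ‖ζ‖ * (κ * (t * (d + ε))) :=
        (le_abs_self _).trans ((ζ.le_opNorm _).trans
          (mul_le_mul_of_nonneg_left hzz' (norm_nonneg _)))
      have hζ3 : t * ζ u = ζ (z'' - z) + ζ (z + t • u - z'') := by
        rw [← map_add, ← smul_eq_mul, ← map_smul]; congr 1; abel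
      have hζ4 : ε * ‖z'' - z‖ ≤ ε * (t * (‖u‖ + κ * (d + ε))) :=
        mul_le_mul_of_nonneg_left hz''z hε.le
      refine le_of_mul_le_mul_left ?_ ht
      calc t * ζ u ≤ ε * (t * (‖u‖ + κ * (d + ε))) + ‖ζ‖ * (κ * (t * (d + ε))) := by linarith
        _ = _ := by ring
    have hcont : Tendsto (fun ε : ℝ => ε * (‖u‖ + κ * (d + ε)) + ‖ζ‖ * (κ * (d + ε)))
        (𝓝[>] 0) (𝓝 (κ * ‖ζ‖ * d)) := by
      have : Continuous fun ε : ℝ => ε * (‖u‖ + κ * (d + ε)) + ‖ζ‖ * (κ * (d + ε)) := by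
        fun_prop
      refine tendsto_nhdsWithin_of_tendsto_nhds ?_
      convert this.tendsto 0 using 2
      ring
    exact ge_of_tendsto hcont (by filter_upwards [self_mem_nhdsWithin] with ε h using hε ε h)
  obtain ⟨μ, hμA, hμT, hμn⟩ := exists_dual_comp_eq_of_le_dist A ζ
    -- Adjoining the ray through `-Φ z` to `K` encodes complementarity: polarity then gives both
    -- signs of `μ (Φ z)`.
    ((K.toSubmodule : PointedCone ℝ E) ⊔ Submodule.span _ {-Φ z})
    (mul_nonneg hκ (norm_nonneg ζ)) (by
      intro u s hs
      obtain ⟨w, hw, s', hs', rfl⟩ := Submodule.mem_sup.1 hs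
      obtain ⟨c, rfl⟩ := Submodule.mem_span_singleton.1 hs'
      have := key u w hw c c.2
      rwa [sub_eq_add_neg w, ← smul_neg] at this)
  have hμK : ∀ w ∈ K, μ w ≤ 0 := fun w hw => hμT w (Submodule.mem_sup_left hw)
  refine ⟨μ, hμA, hμK, le_antisymm (hμK _ hzK) ?_, hμn⟩
  have := hμT (-Φ z) (Submodule.mem_sup_right (Submodule.mem_span_singleton_self _))
  rw [map_neg] at this
  linarith

/-- Multipliers for limiting normals to a set described by a cone constraint that satisfies a
linear error bound. -/
theorem exists_multiplier_of_mem_normalCone [FiniteDimensional ℝ E] {Φ : Z → E}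
    {Φ' : Z → Z →L[ℝ] E} {K : ProperCone ℝ E} {Ω : Set Z} {z : Z} {κ : ℝ} (hκ : 0 ≤ κ)
    (hΦ : ∀ᶠ z' in 𝓝 z, HasFDerivAt Φ (Φ' z') z') (hΦ' : ContinuousAt Φ' z)
    (hΩ : ∀ᶠ z' in 𝓝 z, z' ∈ Ω → Φ z' ∈ K)
    (hbd : ∀ᶠ z' in 𝓝 z, ∀ w ∈ K, ∃ z'' ∈ Ω, ‖z' - z''‖ ≤ κ * ‖Φ z' - w‖)
    {ζ : StrongDual ℝ Z} (hζ : ζ ∈ normalCone Ω z) :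
    ∃ μ : StrongDual ℝ E, μ.comp (Φ' z) = ζ ∧ (∀ w ∈ K, μ w ≤ 0) ∧ μ (Φ z) = 0 ∧
      ‖μ‖ ≤ κ * ‖ζ‖ := by
  obtain ⟨-, w, η, hw, hη, hreg⟩ := hζ
  have hev : ∀ᶠ k in atTop, ∃ μ : StrongDual ℝ E, μ.comp (Φ' (w k)) = η k ∧
      (∀ v ∈ K, μ v ≤ 0) ∧ μ (Φ (w k)) = 0 ∧ ‖μ‖ ≤ κ * ‖η k‖ := by
    filter_upwards [hw.eventually hΦ, hw.eventually hΩ, hw.eventually hbd.eventually_nhds]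
      with k h1 h2 h3
    exact exists_multiplier_of_mem_regularNormalCone hκ h1 (h2 (hreg k).1) h3 (hreg k)
  obtain ⟨N, hN⟩ := eventually_atTop.1 hev
  choose μ hμ1 hμ2 hμ3 hμ4 using fun k => hN (k + N) (Nat.le_add_left N k)
  have hw := hw.comp (tendsto_add_atTop_nat N)
  have hη := hη.comp (tendsto_add_atTop_nat N)
  obtain ⟨R, hR⟩ := hη.norm.bddAbove_range
  have hbdd : ∀ k, μ k ∈ Metric.closedBall (0 : StrongDual ℝ E) (κ * R) := fun k => by
    rw [mem_closedBall_zero_iff]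
    exact (hμ4 k).trans (mul_le_mul_of_nonneg_left (hR ⟨k, rfl⟩) hκ)
  have : ProperSpace (StrongDual ℝ E) := FiniteDimensional.proper_real _
  obtain ⟨μ₀, -, φ, hφ, hlim⟩ := (isCompact_closedBall (0 : StrongDual ℝ E) (κ * R)).tendsto_subseq
    hbdd
  have hw := hw.comp hφ.tendsto_atTop
  have hη := hη.comp hφ.tendsto_atTop
  have hΦz : ContinuousAt Φ z := hΦ.self_of_nhds.continuousAt
  refine ⟨μ₀, ?_, fun v hv => ?_, ?_, ?_⟩
  · have h1 := tendsto_clm_comp hlim (hΦ'.tendsto.comp hw)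
    refine tendsto_nhds_unique (h1.congr fun k => ?_) hη
    exact hμ1 (φ k)
  · exact le_of_tendsto' (tendsto_clm_apply hlim tendsto_const_nhds) fun k => hμ2 (φ k) v hv
  · have h1 := tendsto_clm_apply hlim (hΦz.tendsto.comp hw)
    exact tendsto_nhds_unique (h1.congr fun k => hμ3 (φ k)) tendsto_const_nhds
  · exact le_of_tendsto_of_tendsto' hlim.norm (hη.norm.const_mul κ) fun k => hμ4 (φ k)

end Multipliers

/-! ### Second-order chain rules and Taylor expansion. -/

section SecondOrderCalculus

variable {Z Y W P X : Type*} [NormedAddCommGroup Z] [NormedSpace ℝ Z]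
  [NormedAddCommGroup Y] [NormedSpace ℝ Y] [NormedAddCommGroup W] [NormedSpace ℝ W]
  [NormedAddCommGroup P] [NormedSpace ℝ P] [NormedAddCommGroup X] [NormedSpace ℝ X]

theorem eventually_hasFDerivAt_of_contDiffAt {g : Z → Y} {z : Z} {n : ℕ∞} (hn : n ≠ 0)
    (hg : ContDiffAt ℝ n g z) : ∀ᶠ z' in 𝓝 z, HasFDerivAt g (fderiv ℝ g z') z' := by
  have h1 : ContDiffAt ℝ 1 g z :=
    hg.of_le (by exact_mod_cast Order.one_le_iff_ne_zero.2 hn)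
  filter_upwards [h1.eventually (by simp)] with z' hz'
  exact (hz'.differentiableAt (by simp)).hasFDerivAt

theorem hasFDerivAt_fderiv_of_contDiffAt {g : Z → Y} {z : Z} (hg : ContDiffAt ℝ 2 g z) :
    HasFDerivAt (fderiv ℝ g) (secondDeriv g z) z :=
  ((hg.fderiv_right (m := 1) (by norm_num)).differentiableAt (by simp)).hasFDerivAt

theorem secondDeriv_comp {φ : Y → W} {g : Z → Y} {z : Z} (hg : ContDiffAt ℝ 2 g z)
    (hφ : ContDiffAt ℝ 2 φ (g z)) (u v : Z) :
    secondDeriv (φ ∘ g) z u v =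
      secondDeriv φ (g z) (fderiv ℝ g z u) (fderiv ℝ g z v) +
        fderiv ℝ φ (g z) (secondDeriv g z u v) := by
  have hg1 := eventually_hasFDerivAt_of_contDiffAt (n := 2) (by simp) hg
  have hφ1 := eventually_hasFDerivAt_of_contDiffAt (n := 2) (by simp) hφ
  have heq : fderiv ℝ (φ ∘ g) =ᶠ[𝓝 z] fun z' => (fderiv ℝ φ (g z')).comp (fderiv ℝ g z') := by
    filter_upwards [hg1, hg.continuousAt.eventually hφ1] with z' h1 h2
    exact (h2.comp z' h1).fderiv
  have h1 : HasFDerivAt (fun z' => fderiv ℝ φ (g z'))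
      ((secondDeriv φ (g z)).comp (fderiv ℝ g z)) z :=
    (hasFDerivAt_fderiv_of_contDiffAt hφ).comp z hg1.self_of_nhds
  have h2 := h1.clm_comp (hasFDerivAt_fderiv_of_contDiffAt hg)
  have h3 : secondDeriv (φ ∘ g) z = _ := (h2.congr_of_eventuallyEq heq).fderiv
  rw [h3]
  simp [add_comm]

theorem secondDeriv_clm_comp (μ : Y →L[ℝ] W) {g : Z → Y} {z : Z} (hg : ContDiffAt ℝ 2 g z)
    (u v : Z) : secondDeriv (fun z' => μ (g z')) z u v = μ (secondDeriv g z u v) := by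
  have h := secondDeriv_comp (φ := μ) hg μ.contDiff.contDiffAt u v
  have h0 : secondDeriv (μ : Y → W) (g z) = 0 := by
    have : fderiv ℝ (μ : Y → W) = fun _ => μ := funext fun y => μ.fderiv
    rw [secondDeriv, this]
    simp
  rw [h0, μ.fderiv] at h
  simpa [Function.comp_def] using h

theorem secondDeriv_prodMk_right {φ : P × X → W} {p : P} {x : X}
    (hφ : ContDiffAt ℝ 2 φ (p, x)) (u v : X) :
    secondDeriv (fun x' => φ (p, x')) x u v = secondDeriv φ (p, x) (0, u) (0, v) := by
  have hj : ContDiffAt ℝ 2 (fun x' : X => (p, x')) x := by fun_prop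
  have h := secondDeriv_comp (φ := φ) (g := fun x' : X => (p, x')) hj hφ u v
  have hd : fderiv ℝ (fun x' : X => (p, x')) = fun _ => ContinuousLinearMap.inr ℝ P X :=
    funext fun x' => (hasFDerivAt_prodMk_right p x').fderiv
  have h0 : secondDeriv (fun x' : X => (p, x')) x = 0 := by
    rw [secondDeriv, hd]
    simp
  rw [h0, hd] at h
  simpa [Function.comp_def] using h

theorem partialX_eq {φ : P × X → W} {φ' : P × X →L[ℝ] W} {p : P} {x : X}
    (hφ : HasFDerivAt φ φ' (p, x)) :
    fderiv ℝ (fun x' => φ (p, x')) x = φ'.comp (ContinuousLinearMap.inr ℝ P X) :=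
  (hφ.comp x (hasFDerivAt_prodMk_right p x)).fderiv

theorem partialP_eq {φ : P × X → W} {φ' : P × X →L[ℝ] W} {p : P} {x : X}
    (hφ : HasFDerivAt φ φ' (p, x)) :
    fderiv ℝ (fun p' => φ (p', x)) p = φ'.comp (ContinuousLinearMap.inl ℝ P X) :=
  (hφ.comp p (hasFDerivAt_prodMk_left p x)).fderiv

/-- The second-order Taylor expansion along a sequence of shrinking increments. -/
theorem tendsto_taylor_two {g : Z → Y} {z : Z} (hg : ContDiffAt ℝ 2 g z) {ι : Type*}
    {l : Filter ι} {t : ι → ℝ} {v : ι → Z} {v₀ : Z} (ht : ∀ i, 0 < t i) (ht0 : Tendsto t l (𝓝 0))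
    (hv : Tendsto v l (𝓝 v₀)) :
    Tendsto (fun i => (t i ^ 2)⁻¹ • (g (z + t i • v i) - g z - t i • fderiv ℝ g z (v i))) l
      (𝓝 ((2 : ℝ)⁻¹ • secondDeriv g z v₀ v₀)) := by
  have hsymm : ∀ a b, secondDeriv g z a b = secondDeriv g z b a :=
    (hg.isSymmSndFDerivAt (by simp)).eq
  set r : Z → Y := fun z' => g z' - g z - fderiv ℝ g z (z' - z) -
    (2 : ℝ)⁻¹ • secondDeriv g z (z' - z) (z' - z) with hr
  have hr0 : r z = 0 := by simp [hr]
  have hlim : Tendsto (fun i => secondDeriv g z (v i) (v i)) l (𝓝 (secondDeriv g z v₀ v₀)) :=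
    tendsto_clm_apply (tendsto_clm_apply tendsto_const_nhds hv) hv
  have hder : ∀ᶠ z' in 𝓝 z, HasFDerivAt r
      (fderiv ℝ g z' - fderiv ℝ g z - secondDeriv g z (z' - z)) z' := by
    filter_upwards [eventually_hasFDerivAt_of_contDiffAt (n := 2) (by simp) hg] with z' h1
    have hid : HasFDerivAt (fun w : Z => w - z) (ContinuousLinearMap.id ℝ Z) z' :=
      (hasFDerivAt_id z').sub_const z
    have h2 : HasFDerivAt (fun w => fderiv ℝ g z (w - z)) (fderiv ℝ g z) z' :=
      (fderiv ℝ g z).hasFDerivAt.comp z' hid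
    have h3 : HasFDerivAt (fun w => secondDeriv g z (w - z)) (secondDeriv g z) z' :=
      (secondDeriv g z).hasFDerivAt.comp z' hid
    have h4 := ((h1.sub_const (g z)).sub h2).sub ((h3.clm_apply hid).const_smul (2 : ℝ)⁻¹)
    refine h4.congr_fderiv ?_
    ext a
    -- Symmetry merges the two halves from differentiating the quadratic term.
    have : secondDeriv g z a (z' - z) = secondDeriv g z (z' - z) a := hsymm _ _
    simp only [sub_apply, smul_apply,
      add_apply, ContinuousLinearMap.comp_apply,
      ContinuousLinearMap.flip_apply, ContinuousLinearMap.id_apply, this]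
    module
  -- Mean value inequality on the ball of radius `‖z' - z‖`, where the derivative of `r` is at most
  -- `ε * ‖z' - z‖`.
  have hlittle : ∀ ε : ℝ, 0 < ε → ∀ᶠ z' in 𝓝 z, ‖r z'‖ ≤ ε * ‖z' - z‖ * ‖z' - z‖ := by
    intro ε hε
    have h1 := (hasFDerivAt_fderiv_of_contDiffAt hg).isLittleO.def hε
    obtain ⟨δ, hδ, hball⟩ := Metric.eventually_nhds_iff_ball.1 (h1.and hder)
    filter_upwards [Metric.ball_mem_nhds z hδ] with z' hz'
    have hsub : Metric.closedBall z ‖z' - z‖ ⊆ Metric.ball z δ :=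
      Metric.closedBall_subset_ball (by simpa [dist_eq_norm] using hz')
    have := (convex_closedBall z ‖z' - z‖).norm_image_sub_le_of_norm_hasFDerivWithin_le
      (f := r) (C := ε * ‖z' - z‖) (x := z) (y := z')
      (fun w hw => (hball w (hsub hw)).2.hasFDerivWithinAt)
      (fun w hw => (hball w (hsub hw)).1.trans
        (mul_le_mul_of_nonneg_left (by simpa [dist_eq_norm] using hw) hε.le))
      (Metric.mem_closedBall_self (norm_nonneg _)) (by simp [dist_eq_norm])
    simpa [hr0] using this
  have hz : Tendsto (fun i => z + t i • v i) l (𝓝 z) := by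
    simpa using (ht0.smul hv).const_add z
  have hrem : Tendsto (fun i => (t i ^ 2)⁻¹ • r (z + t i • v i)) l (𝓝 0) := by
    rw [tendsto_zero_iff_norm_tendsto_zero, Metric.tendsto_nhds]
    intro ε hε
    have hb : ∀ᶠ i in l, ‖v i‖ < ‖v₀‖ + 1 := hv.norm.eventually_lt_const (by linarith)
    set c := ε / (‖v₀‖ + 1) ^ 2 / 2 with hc
    have hv1 : 0 < ‖v₀‖ + 1 := by positivity
    have hcpos : 0 < c := by positivity
    filter_upwards [hz.eventually (hlittle c hcpos), hb] with i h1 h2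
    simp only [add_sub_cancel_left, norm_smul, Real.norm_of_nonneg (ht i).le] at h1
    rw [dist_zero_right, norm_norm, norm_smul, norm_inv, Real.norm_of_nonneg (sq_nonneg (t i)),
      inv_mul_lt_iff₀ (pow_pos (ht i) 2)]
    calc ‖r (z + t i • v i)‖ ≤ t i ^ 2 * (c * ‖v i‖ ^ 2) := by linarith
      _ ≤ t i ^ 2 * (c * (‖v₀‖ + 1) ^ 2) := by gcongr
      _ = t i ^ 2 * (ε / 2) := by rw [hc]; field_simp
      _ < t i ^ 2 * ε := by
        have := ht i
        gcongr
        linarith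
  have := hrem.add (hlim.const_smul (2 : ℝ)⁻¹)
  rw [zero_add] at this
  refine this.congr fun i => ?_
  have hti : (t i ^ 2)⁻¹ * t i ^ 2 = 1 := inv_mul_cancel₀ (pow_pos (ht i) 2).ne'
  simp only [hr, add_sub_cancel_left, map_smul, smul_apply]
  have h5 : (2 : ℝ)⁻¹ • secondDeriv g z (v i) (v i) =
      ((t i ^ 2)⁻¹ * t i ^ 2) • (2 : ℝ)⁻¹ • secondDeriv g z (v i) (v i) := by rw [hti, one_smul]
  rw [h5]
  module

end SecondOrderCalculus

/-! ### Error bounds from the reduction and from Robinson stability. -/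

section ErrorBounds

variable {P X Y E : Type*}
  [NormedAddCommGroup P] [NormedAddCommGroup X]
  [NormedAddCommGroup Y] [InnerProductSpace ℝ Y]
  [NormedAddCommGroup E] [InnerProductSpace ℝ E]

theorem IsC2ConeReduction.contDiffAt {C : Set Y} {y : Y} {h : Y → E} {K : ProperCone ℝ E}
    (hred : IsC2ConeReduction C y h K) : ContDiffAt ℝ 2 h y := by
  obtain ⟨V, hV, hy, hh, -⟩ := hred
  exact hh.contDiffAt (hV.mem_nhds hy)

theorem IsC2ConeReduction.eventually_mem_iff {C : Set Y} {y : Y} {h : Y → E} {K : ProperCone ℝ E}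
    (hred : IsC2ConeReduction C y h K) : ∀ᶠ y' in 𝓝 y, y' ∈ C ↔ h y' ∈ K := by
  obtain ⟨V, hV, hy, -, -, -, hCV⟩ := hred
  filter_upwards [hV.mem_nhds hy] with y' hy'
  have := Set.ext_iff.1 hCV y'
  simpa [hy'] using this

/-- Surjectivity of `∇h` makes `h` open at a linear rate near `y`, so `h y'' = w` is solvable at
distance proportional to `‖h y' - w‖`, and `y'' ∈ C` since `w ∈ K`. -/
theorem IsC2ConeReduction.exists_errorBound [FiniteDimensional ℝ Y] [FiniteDimensional ℝ E]
    {C : Set Y} {y : Y} {h : Y → E} {K : ProperCone ℝ E} (hred : IsC2ConeReduction C y h K) :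
    ∃ c : ℝ, 0 ≤ c ∧ ∀ᶠ y' in 𝓝 y, ∀ w ∈ K, ∃ y'' ∈ C, ‖y' - y''‖ ≤ c * ‖h y' - w‖ := by
  have hmem := hred.eventually_mem_iff
  have hh := hred.contDiffAt
  obtain ⟨-, -, -, -, hy0, hsurj, -⟩ := hred
  have : CompleteSpace Y := FiniteDimensional.complete ℝ Y
  have : CompleteSpace E := FiniteDimensional.complete ℝ E
  have hrange : LinearMap.range (fderiv ℝ h y : Y →ₗ[ℝ] E) = ⊤ := LinearMap.range_eq_top.2 hsurj
  set R := (fderiv ℝ h y).nonlinearRightInverseOfSurjective hrange with hR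
  have hRpos : 0 < R.nnnorm :=
    (fderiv ℝ h y).nonlinearRightInverseOfSurjective_nnnorm_pos hrange
  have hstrict : HasStrictFDerivAt h (fderiv ℝ h y) y := hh.hasStrictFDerivAt (by simp)
  -- With half of `R.nnnorm⁻¹` as approximation constant, a ball of radius `2 * R.nnnorm * ‖h y' -
  -- w‖` has an image covering exactly the radius needed to reach `w`.
  obtain ⟨s, hs, happ⟩ := hstrict.approximates_deriv_on_nhds (c := R.nnnorm⁻¹ / 2)
    (Or.inr (by positivity))
  obtain ⟨r, hr, hball⟩ := Metric.mem_nhds_iff.1 (inter_mem hs hmem)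
  have hyC : y ∈ C := hmem.self_of_nhds.2 (hy0 ▸ zero_mem K)
  have hN : (0 : ℝ) < R.nnnorm := hRpos
  refine ⟨2 * R.nnnorm, by positivity, ?_⟩
  filter_upwards [Metric.ball_mem_nhds y (half_pos hr)] with y' hy' w hw
  rw [mem_ball_iff_norm] at hy'
  by_cases hsmall : 2 * R.nnnorm * ‖h y' - w‖ < r / 2
  · have hsub : Metric.closedBall y' (2 * R.nnnorm * ‖h y' - w‖) ⊆ s ∩ {x | x ∈ C ↔ h x ∈ K} := by
      refine Subset.trans (fun x hx => ?_) hball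
      rw [mem_closedBall_iff_norm] at hx
      rw [mem_ball_iff_norm]
      have : x - y = (x - y') + (y' - y) := by abel
      rw [this]
      exact (norm_add_le _ _).trans_lt (by linarith)
    have hon := happ.surjOn_closedBall_of_nonlinearRightInverse R
      (ε := 2 * R.nnnorm * ‖h y' - w‖) (by positivity) (hsub.trans inter_subset_left)
    obtain ⟨y'', hy'', rfl⟩ := hon (a := w) (by
      rw [mem_closedBall_iff_norm, norm_sub_rev]
      refine le_of_eq ?_
      push_cast
      field_simp
      norm_num)
    refine ⟨y'', (hsub hy'').2.2 hw, ?_⟩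
    rw [mem_closedBall_iff_norm, norm_sub_rev] at hy''
    exact hy''
  -- If `w` is far from `h y'`, the reference point itself is close enough.
  · exact ⟨y, hyC, by linarith⟩

theorem RobinsonStable.exists_errorBound [FiniteDimensional ℝ Y] [FiniteDimensional ℝ E]
    {g : P × X → Y} {C : Set Y} {h : Y → E} {K : ProperCone ℝ E} {p₀ : P} {x₀ : X}
    (hRS : RobinsonStable g C p₀ x₀) (hg : ContinuousAt g (p₀, x₀))
    (hred : IsC2ConeReduction C (g (p₀, x₀)) h K) :
    ∃ κ : ℝ, 0 ≤ κ ∧ ∀ᶠ z in 𝓝 (p₀, x₀), ∀ w ∈ K, ∃ x' ∈ feasibleSet g C z.1,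
      ‖z.2 - x'‖ ≤ κ * ‖h (g z) - w‖ := by
  obtain ⟨c, hc, hcb⟩ := hred.exists_errorBound
  obtain ⟨κ, W, hW, U, hU, hκ⟩ := hRS
  -- The extra `1` makes the bound strict, so a feasible point realizes it without attainment of the
  -- distance. This needs `h (g z) ≠ w`; otherwise `z.2` itself is feasible.
  refine ⟨κ * c + 1, by positivity, ?_⟩
  filter_upwards [prod_mem_nhds hW hU, hg.eventually hcb, hg.eventually hred.eventually_mem_iff]
    with z hz hzc hzC w hw
  by_cases h0 : h (g z) - w = 0
  · refine ⟨z.2, hzC.2 ?_, by simp [h0]⟩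
    rwa [sub_eq_zero.1 h0]
  · obtain ⟨y, hy, hyb⟩ := hzc w hw
    have hk : 0 ≤ (κ : ℝ) := κ.2
    have h1 : Metric.infEDist z.2 (feasibleSet g C z.1) ≤
        ENNReal.ofReal (κ * (c * ‖h (g z) - w‖)) := by
      refine (hκ z.1 hz.1 z.2 hz.2).trans ?_
      rw [ENNReal.ofReal_mul hk, ENNReal.ofReal_coe_nnreal]
      refine mul_le_mul_right ((Metric.infEDist_le_edist_of_mem hy).trans ?_) _
      rw [edist_dist, dist_eq_norm]
      exact ENNReal.ofReal_le_ofReal hyb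
    have hpos : 0 < ‖h (g z) - w‖ := norm_pos_iff.2 h0
    have h2 : Metric.infEDist z.2 (feasibleSet g C z.1) <
        ENNReal.ofReal ((κ * c + 1) * ‖h (g z) - w‖) := by
      refine h1.trans_lt ((ENNReal.ofReal_lt_ofReal_iff (by positivity)).2 ?_)
      linarith
    obtain ⟨x', hx', hlt⟩ := Metric.infEDist_lt_iff.1 h2
    refine ⟨x', hx', ?_⟩
    rw [edist_dist, dist_eq_norm] at hlt
    exact ((ENNReal.ofReal_lt_ofReal_iff (by positivity)).1 hlt).le

end ErrorBounds

/-! ### Linear selection on the characteristic subspace. -/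

section Selection

variable {P X E : Type*} [NormedAddCommGroup P] [NormedSpace ℝ P] [FiniteDimensional ℝ P]
  [NormedAddCommGroup X] [NormedSpace ℝ X] [NormedAddCommGroup E] [NormedSpace ℝ E]

/-- On the subspace of those `q` with `B q ∈ rge A + lin K`, the preimage under `A` can be chosen
linearly and continuously. -/
theorem exists_continuousLinearMap_selection (A : X →L[ℝ] E) (B : P →L[ℝ] E)
    (K : ProperCone ℝ E) :
    ∃ σ : P →L[ℝ] X, ∀ q u e, e ∈ K → -e ∈ K → B q = A u + e →
      ∃ e', e' ∈ K ∧ -e' ∈ K ∧ B q = A (σ q) + e' := by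
  set L : Submodule ℝ E := PointedCone.lineal K.toSubmodule
  set D : X →ₗ[ℝ] E ⧸ L := L.mkQ ∘ₗ (A : X →ₗ[ℝ] E) with hD
  -- A linear right inverse onto the range modulo `lin K`, extended to the whole quotient;
  -- continuity of the resulting map comes from `dim P < ∞`.
  obtain ⟨s, hs⟩ := D.rangeRestrict.exists_rightInverse_of_surjective D.range_rangeRestrict
  obtain ⟨s', hs'⟩ := s.exists_extend
  refine ⟨LinearMap.toContinuousLinearMap (s' ∘ₗ L.mkQ ∘ₗ (B : P →ₗ[ℝ] E)),
    fun q u e he he' hq => ?_⟩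
  have hDu : D u = L.mkQ (B q) := by
    have h0 : L.mkQ e = 0 := (Submodule.Quotient.mk_eq_zero L).2 ⟨he, he'⟩
    rw [hq, map_add, h0, add_zero]
    rfl
  have hsq : D (s' (L.mkQ (B q))) = L.mkQ (B q) := by
    rw [← hDu]
    have h1 : s' (D u) = s ⟨D u, u, rfl⟩ := LinearMap.congr_fun hs' ⟨D u, u, rfl⟩
    have h2 := LinearMap.congr_fun hs ⟨D u, u, rfl⟩
    rw [h1]
    exact congrArg Subtype.val h2
  have hmem : B q - A (s' (L.mkQ (B q))) ∈ L := (Submodule.Quotient.eq L).1 hsq.symm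
  exact ⟨_, hmem.1, hmem.2, (add_sub_cancel _ _).symm⟩

end Selection

/-! ### The two asymptotic inequalities for the Lagrangian derivative. -/

section Core

variable {P X E : Type*} [NormedAddCommGroup P] [NormedSpace ℝ P]
  [NormedAddCommGroup X] [NormedSpace ℝ X] [NormedAddCommGroup E] [NormedSpace ℝ E]

theorem tendsto_slope {Z W : Type*} [NormedAddCommGroup Z] [NormedSpace ℝ Z]
    [NormedAddCommGroup W] [NormedSpace ℝ W] {φ : Z → W} {φ' : Z →L[ℝ] W} {z : Z}
    (hφ : HasFDerivAt φ φ' z) {ι : Type*} {l : Filter ι} {t : ι → ℝ} {v : ι → Z} {v₀ : Z}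
    (ht : ∀ i, 0 < t i) (ht0 : Tendsto t l (𝓝 0)) (hv : Tendsto v l (𝓝 v₀)) :
    Tendsto (fun i => (t i)⁻¹ • (φ (z + t i • v i) - φ z)) l (𝓝 (φ' v₀)) := by
  refine (hasFDerivWithinAt_univ.2 hφ).lim (d := fun i => t i • v i) ?_
    (.of_forall fun _ => mem_univ _) ?_
  · simpa using ht0.smul hv
  · refine hv.congr fun i => ?_
    rw [smul_smul, inv_mul_cancel₀ (ht i).ne', one_smul]

/-- The derivative of the Lagrangian field `f + (∇ₓG)* μ` in the direction `v`. -/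
noncomputable def lagrangianDeriv (f' : P × X →L[ℝ] StrongDual ℝ X) (G : P × X → E) (z : P × X)
    (μ : StrongDual ℝ E) (v : P × X) : StrongDual ℝ X :=
  f' v + μ.comp ((secondDeriv G z v).comp (ContinuousLinearMap.inr ℝ P X))

variable {f : P × X → StrongDual ℝ X} {f' : P × X →L[ℝ] StrongDual ℝ X} {G : P × X → E}
  {z : P × X} {t : ℕ → ℝ} {v : ℕ → P × X} {v₀ : P × X} {μ : ℕ → StrongDual ℝ E}
  {μ₀ : StrongDual ℝ E}

/-- Subtracting stationarity of `ν` at `z` from that of `μ k` at the perturbed point turns the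
quotient into difference quotients of `f` and of `∇ₓG` paired with `μ k`. The limit is therefore
independent of `ν`. -/
theorem tendsto_multiplier_slope (hf : HasFDerivAt f f' z) (hG : ContDiffAt ℝ 2 G z)
    (ht : ∀ k, 0 < t k) (ht0 : Tendsto t atTop (𝓝 0)) (hv : Tendsto v atTop (𝓝 v₀))
    (hμ : Tendsto μ atTop (𝓝 μ₀))
    (hμf : ∀ k, (μ k).comp ((fderiv ℝ G (z + t k • v k)).comp (ContinuousLinearMap.inr ℝ P X)) =
      -f (z + t k • v k))
    {ν : StrongDual ℝ E}
    (hν : ν.comp ((fderiv ℝ G z).comp (ContinuousLinearMap.inr ℝ P X)) = -f z) :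
    Tendsto (fun k => (t k)⁻¹ •
      (ν - μ k).comp ((fderiv ℝ G z).comp (ContinuousLinearMap.inr ℝ P X)))
      atTop (𝓝 (lagrangianDeriv f' G z μ₀ v₀)) := by
  have h1 := tendsto_slope hf ht ht0 hv
  have h2 := tendsto_slope (hasFDerivAt_fderiv_of_contDiffAt hG) ht ht0 hv
  have h3 := tendsto_clm_comp hμ (tendsto_clm_comp h2
    (tendsto_const_nhds (x := ContinuousLinearMap.inr ℝ P X)))
  refine (h1.add h3).congr fun k => ?_
  ext a
  have e1 := congrArg (fun ξ : StrongDual ℝ X => ξ a) (hμf k)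
  have e2 := congrArg (fun ξ : StrongDual ℝ X => ξ a) hν
  simp only [ContinuousLinearMap.comp_apply, neg_apply] at e1 e2
  simp only [add_apply, smul_apply, sub_apply, ContinuousLinearMap.comp_apply, map_smul, map_sub,
    smul_eq_mul]
  rw [e1, e2]
  ring

/-- The quotients with `ν = μ₀` are nonnegative at `u`, because `μ₀` vanishes at `∇ₓG u` while each
`μ k` is nonpositive there. -/
theorem lagrangianDeriv_nonneg (hf : HasFDerivAt f f' z) (hG : ContDiffAt ℝ 2 G z)
    {K : ProperCone ℝ E}
    (ht : ∀ k, 0 < t k) (ht0 : Tendsto t atTop (𝓝 0)) (hv : Tendsto v atTop (𝓝 v₀))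
    (hμ : Tendsto μ atTop (𝓝 μ₀)) (hμK : ∀ k, ∀ w ∈ K, μ k w ≤ 0)
    (hμf : ∀ k, (μ k).comp ((fderiv ℝ G (z + t k • v k)).comp (ContinuousLinearMap.inr ℝ P X)) =
      -f (z + t k • v k))
    (hμ₀ : μ₀.comp ((fderiv ℝ G z).comp (ContinuousLinearMap.inr ℝ P X)) = -f z)
    {u : X} (huK : fderiv ℝ G z (0, u) ∈ K) (hu : μ₀ (fderiv ℝ G z (0, u)) = 0) :
    0 ≤ lagrangianDeriv f' G z μ₀ v₀ u := by
  have h := tendsto_clm_apply (tendsto_multiplier_slope hf hG ht ht0 hv hμ hμf hμ₀)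
    (tendsto_const_nhds (x := u))
  refine ge_of_tendsto' h fun k => ?_
  have h1 := hμK k _ huK
  have h2 : 0 ≤ (t k)⁻¹ := (inv_pos.2 (ht k)).le
  simp only [smul_apply, ContinuousLinearMap.comp_apply, sub_apply, smul_eq_mul,
    ContinuousLinearMap.inr_apply, hu]
  exact mul_nonneg h2 (by linarith)

/-- Complementarity of `μ k` and polarity of `ν` give `(ν - μ k)(G) ≤ 0` at the perturbed point.
Divide by `t k ^ 2` and expand: the first-order term splits into an `X`-part governed by the slope
limit, a part in `lin K` that is annihilated, and a remainder of size `r k`. -/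
theorem lagrangianDeriv_add_le [FiniteDimensional ℝ P] (hf : HasFDerivAt f f' z)
    (hG : ContDiffAt ℝ 2 G z)
    (hGz : G z = 0) {K : ProperCone ℝ E} {u₀ : X} {r : ℕ → P}
    (ht : ∀ k, 0 < t k) (ht0 : Tendsto t atTop (𝓝 0)) (hv : Tendsto v atTop (𝓝 (0, u₀)))
    (hr : Tendsto r atTop (𝓝 0))
    (hrP : ∀ k, ∃ (u : X) (e : E), e ∈ K ∧ -e ∈ K ∧
      fderiv ℝ G z ((v k).1 - t k • r k, 0) = fderiv ℝ G z (0, u) + e)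
    (hμ : Tendsto μ atTop (𝓝 μ₀)) (hμK : ∀ k, ∀ w ∈ K, μ k w ≤ 0)
    (hGK : ∀ k, G (z + t k • v k) ∈ K) (hμG : ∀ k, μ k (G (z + t k • v k)) = 0)
    (hμf : ∀ k, (μ k).comp ((fderiv ℝ G (z + t k • v k)).comp (ContinuousLinearMap.inr ℝ P X)) =
      -f (z + t k • v k))
    {ν : StrongDual ℝ E} (hνK : ∀ w ∈ K, ν w ≤ 0)
    (hν : ν.comp ((fderiv ℝ G z).comp (ContinuousLinearMap.inr ℝ P X)) = -f z) :
    lagrangianDeriv f' G z μ₀ (0, u₀) u₀ +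
      2⁻¹ * (ν - μ₀) (secondDeriv G z (0, u₀) (0, u₀)) ≤ 0 := by
  set A : X →L[ℝ] E := (fderiv ℝ G z).comp (ContinuousLinearMap.inr ℝ P X) with hA
  set B : P →L[ℝ] E := (fderiv ℝ G z).comp (ContinuousLinearMap.inl ℝ P X) with hB
  obtain ⟨σ, hσ⟩ := exists_continuousLinearMap_selection A B K
  have hslope := tendsto_multiplier_slope hf hG ht ht0 hv hμ hμf hν
  have hv1 : Tendsto (fun k => (v k).1) atTop (𝓝 0) := (continuous_fst.tendsto _).comp hv
  have hv2 : Tendsto (fun k => (v k).2) atTop (𝓝 u₀) := (continuous_snd.tendsto _).comp hv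
  have hdiff : Tendsto (fun k => ν - μ k) atTop (𝓝 (ν - μ₀)) := tendsto_const_nhds.sub hμ
  have hT := tendsto_clm_apply hdiff (tendsto_taylor_two hG ht ht0 hv)
  have hq : Tendsto (fun k => (v k).1 - t k • r k) atTop (𝓝 0) := by
    simpa using hv1.sub (ht0.smul hr)
  -- Continuity of the linear selection is used here: the correction that absorbs the parameter
  -- displacement vanishes in the limit.
  have hσq : Tendsto (fun k => (v k).2 + σ ((v k).1 - t k • r k)) atTop (𝓝 u₀) := by
    simpa using hv2.add ((σ.continuous.tendsto 0).comp hq)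
  have hX := tendsto_clm_apply hslope hσq
  have hR : Tendsto (fun k => (ν - μ k) (B (r k))) atTop (𝓝 0) := by
    simpa using tendsto_clm_apply hdiff ((B.continuous.tendsto 0).comp hr)
  have hsum := (hX.add hT).add hR
  rw [add_zero, map_smul, smul_eq_mul] at hsum
  refine le_of_tendsto' hsum fun k => ?_
  -- Functionals nonpositive on `K` vanish on `lin K`.
  have hμlin : ∀ e, e ∈ K → -e ∈ K → (ν - μ k) e = 0 := by
    intro e he he'
    have h1 := hνK e he
    have h2 := hνK _ he'
    have h3 := hμK k e he
    have h4 := hμK k _ he'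
    rw [map_neg] at h2 h4
    rw [sub_apply]
    linarith
  obtain ⟨u, e, he, he', hue⟩ := hrP k
  obtain ⟨e₁, he₁, he₁', hB₁⟩ := hσ ((v k).1 - t k • r k) u e he he' hue
  have hsplit : fderiv ℝ G z (v k) =
      A ((v k).2 + σ ((v k).1 - t k • r k)) + e₁ + t k • B (r k) := by
    have h1 : fderiv ℝ G z (v k) = B (v k).1 + A (v k).2 := by
      rw [hA, hB, ContinuousLinearMap.comp_apply, ContinuousLinearMap.comp_apply, ← map_add]
      simp
    have h2 : B (v k).1 = B ((v k).1 - t k • r k) + t k • B (r k) := by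
      rw [map_sub, map_smul]; abel
    rw [h1, h2, hB₁, map_add]
    abel
  have hval : (ν - μ k) (fderiv ℝ G z (v k)) =
      (ν - μ k) (A ((v k).2 + σ ((v k).1 - t k • r k))) + t k * (ν - μ k) (B (r k)) := by
    rw [hsplit, map_add, map_add, hμlin e₁ he₁ he₁', add_zero, map_smul, smul_eq_mul]
  have hneg : (ν - μ k) (G (z + t k • v k)) ≤ 0 := by
    rw [sub_apply, hμG, sub_zero]
    exact hνK _ (hGK k)
  have htk := ht k
  have hexp : (t k ^ 2)⁻¹ * (ν - μ k) (G (z + t k • v k)) =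
      (((t k)⁻¹ • (ν - μ k).comp A) ((v k).2 + σ ((v k).1 - t k • r k)) +
        (ν - μ k) ((t k ^ 2)⁻¹ • (G (z + t k • v k) - G z - t k • fderiv ℝ G z (v k)))) +
      (ν - μ k) (B (r k)) := by
    rw [hGz, sub_zero, map_smul (ν - μ k), map_sub (ν - μ k), map_smul (ν - μ k), hval,
      smul_apply, ContinuousLinearMap.comp_apply]
    simp only [smul_eq_mul]
    field_simp
    ring
  rw [← hexp]
  exact mul_nonpos_of_nonneg_of_nonpos (by positivity) hneg

end Core

/-! ### Normals and tangents of cone-constrained sets at a zero of the constraint map. -/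

section Cones

variable {Z E : Type*} [NormedAddCommGroup Z] [NormedSpace ℝ Z]
  [NormedAddCommGroup E] [NormedSpace ℝ E]

theorem regularNormalCone_subset_normalCone (Ω : Set Z) (z : Z) :
    regularNormalCone Ω z ⊆ normalCone Ω z := fun ζ hζ =>
  ⟨hζ.1, fun _ => z, fun _ => ζ, tendsto_const_nhds, tendsto_const_nhds, fun _ => hζ⟩

theorem comp_mem_normalCone {Φ : Z → E} {A : Z →L[ℝ] E} {K : ProperCone ℝ E} {Ω : Set Z} {z : Z}
    (hΦ : HasFDerivAt Φ A z) (hΦz : Φ z = 0) (hzΩ : z ∈ Ω)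
    (hΩ : ∀ᶠ z' in 𝓝 z, z' ∈ Ω → Φ z' ∈ K) {μ : StrongDual ℝ E} (hμ : ∀ w ∈ K, μ w ≤ 0) :
    μ.comp A ∈ normalCone Ω z := by
  refine regularNormalCone_subset_normalCone Ω z ⟨hzΩ, fun ε hε => ?_⟩
  have h1 := ((μ.hasFDerivAt (x := Φ z)).comp z hΦ).isLittleO.def hε
  refine eventually_nhdsWithin_iff.2 ?_
  filter_upwards [h1, hΩ] with w hw hwΩ hwmem
  have h2 := hμ _ (hwΩ hwmem)
  have h3 := (neg_le_abs _).trans hw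
  simp only [Function.comp_apply, hΦz, map_zero, sub_zero] at h3
  linarith

theorem fderiv_mem_of_mem_tangentCone {Φ : Z → E} {A : Z →L[ℝ] E} {K : ProperCone ℝ E}
    {Ω : Set Z} {z : Z} (hΦ : HasFDerivAt Φ A z) (hΦz : Φ z = 0)
    (hΩ : ∀ᶠ z' in 𝓝 z, z' ∈ Ω → Φ z' ∈ K) {u : Z} (hu : u ∈ tangentCone Ω z) : A u ∈ K := by
  obtain ⟨t, w, ht, ht0, hw, hmem⟩ := hu
  have h1 := tendsto_slope hΦ ht ht0 hw
  have h2 : Tendsto (fun k => z + t k • w k) atTop (𝓝 z) := by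
    simpa using (ht0.smul hw).const_add z
  refine K.isClosed.mem_of_tendsto h1 ?_
  filter_upwards [h2.eventually hΩ] with k hk
  rw [hΦz, sub_zero]
  exact properCone_smul_mem K (inv_pos.2 (ht k)).le (hk (hmem k))

end Cones

/-! ### Translation between multipliers for `C` and functionals on `E`. -/

section Identification

variable {P X Y E : Type*}
  [NormedAddCommGroup P] [InnerProductSpace ℝ P]
  [NormedAddCommGroup X] [InnerProductSpace ℝ X]
  [NormedAddCommGroup Y] [InnerProductSpace ℝ Y]
  [NormedAddCommGroup E] [InnerProductSpace ℝ E]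
  {f : P × X → StrongDual ℝ X} {g : P × X → Y} {C : Set Y} {h : Y → E} {K : ProperCone ℝ E}
  {p₀ : P} {x₀ : X}

theorem IsC2ConeReduction.surjective {y : Y} (hred : IsC2ConeReduction C y h K) :
    Function.Surjective (fderiv ℝ h y) := by
  obtain ⟨V, -, -, -, -, hsurj, -⟩ := hred
  exact hsurj

theorem IsC2ConeReduction.apply_eq_zero {y : Y} (hred : IsC2ConeReduction C y h K) :
    h y = 0 := by
  obtain ⟨V, -, -, -, hy0, -⟩ := hred
  exact hy0

/-- Surjectivity of `∇h(y)` makes its adjoint injective, so `Function.invFun` is a genuine left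
inverse. -/
theorem reducedMultiplier_comp {y : Y} (hsurj : Function.Surjective (fderiv ℝ h y))
    (μ : StrongDual ℝ E) : reducedMultiplier h y (μ.comp (fderiv ℝ h y)) = μ := by
  refine Function.leftInverse_invFun (f := fun μ : StrongDual ℝ E => μ.comp (fderiv ℝ h y))
    (fun μ ν hμν => ?_) μ
  ext e
  obtain ⟨v, rfl⟩ := hsurj e
  exact congrArg (fun ξ : StrongDual ℝ Y => ξ v) hμν

theorem curvatureForm_comp {y : Y} (hh : ContDiffAt ℝ 2 h y)
    (hsurj : Function.Surjective (fderiv ℝ h y)) (μ : StrongDual ℝ E) (v w : Y) :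
    curvatureForm h y (μ.comp (fderiv ℝ h y)) v w = μ (secondDeriv h y v w) := by
  rw [curvatureForm, reducedMultiplier_comp hsurj]
  exact secondDeriv_clm_comp μ hh v w

/-- By the chain rule, the curvature term is exactly what turns `∇²g` into `∇²(h ∘ g)`. -/
theorem directionalObjective_comp {z : P × X} (hg : ContDiffAt ℝ 2 g z)
    (hh : ContDiffAt ℝ 2 h (g z)) (hsurj : Function.Surjective (fderiv ℝ h (g z)))
    (μ : StrongDual ℝ E) (v : P × X) :
    directionalObjective g h z v (μ.comp (fderiv ℝ h (g z))) =
      μ (secondDeriv (h ∘ g) z v v) := by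
  rw [directionalObjective, curvatureForm_comp hh hsurj, secondDeriv_comp hg hh, map_add,
    add_comm]
  rfl

theorem operatorF_comp (hf : DifferentiableAt ℝ f (p₀, x₀)) (hg : ContDiffAt ℝ 2 g (p₀, x₀))
    (hh : ContDiffAt ℝ 2 h (g (p₀, x₀)))
    (hsurj : Function.Surjective (fderiv ℝ h (g (p₀, x₀)))) (μ : StrongDual ℝ E) (u u' : X) :
    operatorF f g h p₀ x₀ (μ.comp (fderiv ℝ h (g (p₀, x₀)))) u u' =
      lagrangianDeriv (fderiv ℝ f (p₀, x₀)) (h ∘ g) (p₀, x₀) μ (0, u) u' := by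
  set lam := μ.comp (fderiv ℝ h (g (p₀, x₀))) with hlam
  have hgd : HasFDerivAt g (fderiv ℝ g (p₀, x₀)) (p₀, x₀) :=
    (hg.differentiableAt (by simp)).hasFDerivAt
  have h1 : partialX f p₀ x₀ = (fderiv ℝ f (p₀, x₀)).comp (ContinuousLinearMap.inr ℝ P X) :=
    partialX_eq hf.hasFDerivAt
  have h2 : partialX g p₀ x₀ = (fderiv ℝ g (p₀, x₀)).comp (ContinuousLinearMap.inr ℝ P X) :=
    partialX_eq hgd
  have h3 : secondDeriv (fun x => lam (g (p₀, x))) x₀ u u' =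
      lam (secondDeriv g (p₀, x₀) (0, u) (0, u')) := by
    rw [← secondDeriv_clm_comp lam hg]
    exact secondDeriv_prodMk_right (φ := fun z => lam (g z))
      (lam.contDiff.contDiffAt.comp (p₀, x₀) hg) u u'
  simp only [operatorF, add_apply, h3, curvatureOp, ContinuousLinearMap.comp_apply,
    lagrangianDeriv, h1, h2, ContinuousLinearMap.inr_apply]
  rw [hlam, curvatureForm_comp hh hsurj, secondDeriv_comp hg hh, map_add,
    ContinuousLinearMap.comp_apply]
  ring

theorem fderiv_reduction_comp {z : P × X} (hg : ContDiffAt ℝ 2 g z)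
    (hh : ContDiffAt ℝ 2 h (g z)) :
    fderiv ℝ (h ∘ g) z = (fderiv ℝ h (g z)).comp (fderiv ℝ g z) :=
  fderiv_comp z (hh.differentiableAt (by simp)) (hg.differentiableAt (by simp))

theorem exists_multiplier_of_mem_normalCone_reduction [FiniteDimensional ℝ Y]
    [FiniteDimensional ℝ E] {y : Y} (hred : IsC2ConeReduction C y h K) {lam : StrongDual ℝ Y}
    (hlam : lam ∈ normalCone C y) :
    ∃ μ : StrongDual ℝ E, μ.comp (fderiv ℝ h y) = lam ∧ ∀ w ∈ K, μ w ≤ 0 := by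
  obtain ⟨c, hc, hcb⟩ := hred.exists_errorBound
  have hh := hred.contDiffAt
  obtain ⟨μ, h1, h2, -⟩ := exists_multiplier_of_mem_normalCone hc
    (eventually_hasFDerivAt_of_contDiffAt (n := 2) (by simp) hh)
    (hasFDerivAt_fderiv_of_contDiffAt hh).continuousAt
    (hred.eventually_mem_iff.mono fun _ h => h.1) hcb hlam
  exact ⟨μ, h1, h2⟩

theorem comp_mem_normalCone_of_reduction {y : Y} (hred : IsC2ConeReduction C y h K)
    {μ : StrongDual ℝ E} (hμ : ∀ w ∈ K, μ w ≤ 0) : μ.comp (fderiv ℝ h y) ∈ normalCone C y :=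
  comp_mem_normalCone (hred.contDiffAt.differentiableAt (by simp)).hasFDerivAt
    hred.apply_eq_zero
    (hred.eventually_mem_iff.self_of_nhds.2 (hred.apply_eq_zero ▸ zero_mem K))
    (hred.eventually_mem_iff.mono fun _ h => h.1) hμ

end Identification

/-! ### Refutation of a blow-up sequence. -/

section Contradiction

variable {P X Y E : Type*}
  [NormedAddCommGroup P] [InnerProductSpace ℝ P] [FiniteDimensional ℝ P]
  [NormedAddCommGroup X] [InnerProductSpace ℝ X]
  [NormedAddCommGroup Y] [InnerProductSpace ℝ Y] [FiniteDimensional ℝ Y]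
  [NormedAddCommGroup E] [InnerProductSpace ℝ E] [FiniteDimensional ℝ E]
  {f : P × X → StrongDual ℝ X} {g : P × X → Y} {C : Set Y} {h : Y → E} {K : ProperCone ℝ E}
  {p₀ : P} {x₀ : X}

/-- The second-order condition excludes KKT points that approach the reference point tangentially
to the `X`-space and whose parameters are second-order close to the characteristic subspace. -/
theorem SecondOrderCondition.false_of_tendsto (hf : DifferentiableAt ℝ f (p₀, x₀))
    (hg : ContDiffAt ℝ 2 g (p₀, x₀)) (hred : IsC2ConeReduction C (g (p₀, x₀)) h K)
    (hSOC : SecondOrderCondition f g C h p₀ x₀) {κ : ℝ}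
    {t : ℕ → ℝ} {v : ℕ → P × X} {r : ℕ → P} {μ : ℕ → StrongDual ℝ E} {μ₀ : StrongDual ℝ E}
    {u₀ : X} (hu₀ : u₀ ≠ 0) (ht : ∀ k, 0 < t k) (ht0 : Tendsto t atTop (𝓝 0))
    (hv : Tendsto v atTop (𝓝 (0, u₀))) (hr : Tendsto r atTop (𝓝 0))
    (hrP : ∀ k, (v k).1 - t k • r k ∈ characteristicSubspace g h K p₀ x₀)
    (hμ : Tendsto μ atTop (𝓝 μ₀)) (hμK : ∀ k, ∀ w ∈ K, μ k w ≤ 0)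
    (hGK : ∀ k, h (g ((p₀, x₀) + t k • v k)) ∈ K)
    (hμG : ∀ k, μ k (h (g ((p₀, x₀) + t k • v k))) = 0)
    (hμf : ∀ k, (μ k).comp ((fderiv ℝ (h ∘ g) ((p₀, x₀) + t k • v k)).comp
      (ContinuousLinearMap.inr ℝ P X)) = -f ((p₀, x₀) + t k • v k))
    (hx : ∀ k, ∃ x' ∈ feasibleSet g C p₀, ‖x₀ + t k • (v k).2 - x'‖ ≤
      κ * ‖h (g (p₀, x₀ + t k • (v k).2)) - h (g ((p₀, x₀) + t k • v k))‖) : False := by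
  set z : P × X := (p₀, x₀) with hz
  have hh := hred.contDiffAt
  have hsurj := hred.surjective
  have hG : ContDiffAt ℝ 2 (h ∘ g) z := hh.comp z hg
  have hGz : (h ∘ g) z = 0 := hred.apply_eq_zero
  have hGd : HasFDerivAt (h ∘ g) (fderiv ℝ (h ∘ g) z) z :=
    (hG.differentiableAt (by simp)).hasFDerivAt
  have hgd : HasFDerivAt g (fderiv ℝ g z) z := (hg.differentiableAt (by simp)).hasFDerivAt
  have hfd := hf.hasFDerivAt
  have hchain := fderiv_reduction_comp hg hh
  have hpX : partialX g p₀ x₀ = (fderiv ℝ g z).comp (ContinuousLinearMap.inr ℝ P X) :=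
    partialX_eq hgd
  have hGX : HasFDerivAt (fun x => h (g (p₀, x)))
      ((fderiv ℝ (h ∘ g) z).comp (ContinuousLinearMap.inr ℝ P X)) x₀ :=
    hGd.comp x₀ (hasFDerivAt_prodMk_right p₀ x₀)
  have hzlim : Tendsto (fun k => z + t k • v k) atTop (𝓝 z) := by
    simpa using (ht0.smul hv).const_add z
  have hv2 : Tendsto (fun k => (v k).2) atTop (𝓝 u₀) := (continuous_snd.tendsto _).comp hv
  have hμ₀K : ∀ w ∈ K, μ₀ w ≤ 0 := fun w hw =>
    le_of_tendsto' (tendsto_clm_apply hμ tendsto_const_nhds) fun k => hμK k w hw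
  have hμ₀f : μ₀.comp ((fderiv ℝ (h ∘ g) z).comp (ContinuousLinearMap.inr ℝ P X)) = -f z := by
    have h1 := (hasFDerivAt_fderiv_of_contDiffAt hG).continuousAt.tendsto.comp hzlim
    have h2 := tendsto_clm_comp hμ (tendsto_clm_comp h1
      (tendsto_const_nhds (x := ContinuousLinearMap.inr ℝ P X)))
    exact tendsto_nhds_unique (h2.congr hμf) (hf.continuousAt.tendsto.comp hzlim).neg
  have hslope := tendsto_slope hGd ht ht0 hv
  -- Complementarity, divided by `t k`, in the limit.
  have hμ₀u : μ₀ (fderiv ℝ (h ∘ g) z (0, u₀)) = 0 := by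
    refine tendsto_nhds_unique ((tendsto_clm_apply hμ hslope).congr fun k => ?_)
      tendsto_const_nhds
    rw [hGz, sub_zero, map_smul]
    exact (congrArg _ (hμG k)).trans (smul_zero _)
  have hfu : ∀ u, (-f z) u = μ₀ (fderiv ℝ (h ∘ g) z (0, u)) := fun u => by
    rw [← hμ₀f]; rfl
  -- Feasible points for `p₀` lie within `o(t k)` of the `X`-components: since the parameter part of
  -- `v k` vanishes, the difference quotients of `G` with and without it have the same limit.
  have huT : u₀ ∈ tangentCone (feasibleSet g C p₀) x₀ := by
    choose x' hx' hxb using hx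
    refine ⟨t, fun k => (t k)⁻¹ • (x' k - x₀), ht, ht0, ?_, fun k => ?_⟩
    · have h1 := ((tendsto_slope hGX ht ht0 hv2).sub hslope).norm.const_mul κ
      rw [ContinuousLinearMap.comp_apply, ContinuousLinearMap.inr_apply, sub_self, norm_zero,
        mul_zero] at h1
      have h2 : Tendsto (fun k => (t k)⁻¹ • (x₀ + t k • (v k).2 - x' k)) atTop (𝓝 0) := by
        refine squeeze_zero_norm (fun k => ?_) h1
        have htk : 0 ≤ (t k)⁻¹ := (inv_pos.2 (ht k)).le
        rw [← smul_sub, norm_smul, norm_smul, Real.norm_of_nonneg htk]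
        calc (t k)⁻¹ * ‖x₀ + t k • (v k).2 - x' k‖ ≤ (t k)⁻¹ * (κ *
              ‖h (g (p₀, x₀ + t k • (v k).2)) - h (g (z + t k • v k))‖) :=
              mul_le_mul_of_nonneg_left (hxb k) htk
          _ = κ * ((t k)⁻¹ * ‖h (g (p₀, x₀ + t k • (v k).2)) - h (g (p₀, x₀)) -
              ((h ∘ g) (z + t k • v k) - (h ∘ g) z)‖) := by
              rw [Function.comp_apply, Function.comp_apply, hz, sub_sub_sub_cancel_right]
              ring
      have h3 := hv2.sub h2
      rw [sub_zero] at h3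
      refine h3.congr fun k => ?_
      have : (v k).2 = (t k)⁻¹ • t k • (v k).2 := by
        rw [smul_smul, inv_mul_cancel₀ (ht k).ne', one_smul]
      nth_rw 1 [this]
      rw [← smul_sub]
      congr 1
      abel
    · rw [smul_smul, mul_inv_cancel₀ (ht k).ne', one_smul, add_sub_cancel]
      exact hx' k
  have hΓ : ∀ᶠ x in 𝓝 x₀, x ∈ feasibleSet g C p₀ → h (g (p₀, x)) ∈ K := by
    have hc : ContinuousAt (fun x => g (p₀, x)) x₀ :=
      hg.continuousAt.comp (f := fun x => (p₀, x)) (by fun_prop)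
    exact (hc.eventually hred.eventually_mem_iff).mono fun x hx => hx.1
  have hucrit : u₀ ∈ criticalCone (feasibleSet g C p₀) x₀ (-f z) :=
    ⟨huT, by rw [hfu, hμ₀u]⟩
  have hnonneg : ∀ u ∈ criticalCone (feasibleSet g C p₀) x₀ (-f z),
      0 ≤ lagrangianDeriv (fderiv ℝ f z) (h ∘ g) z μ₀ (0, u₀) u := by
    rintro u ⟨hu, hfu0⟩
    refine lagrangianDeriv_nonneg hfd hG ht ht0 hv hμ hμK hμf hμ₀f
      (fderiv_mem_of_mem_tangentCone hGX hGz hΓ hu) ?_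
    rw [← hfu, hfu0]
  have hrP' : ∀ k, ∃ (u : X) (e : E), e ∈ K ∧ -e ∈ K ∧
      fderiv ℝ (h ∘ g) z ((v k).1 - t k • r k, 0) = fderiv ℝ (h ∘ g) z (0, u) + e := by
    intro k
    obtain ⟨u, e, he, he', hue⟩ := hrP k
    have h1 : partialP (h ∘ g) p₀ x₀ =
        (fderiv ℝ (h ∘ g) z).comp (ContinuousLinearMap.inl ℝ P X) := partialP_eq hGd
    have h2 : partialX (h ∘ g) p₀ x₀ =
        (fderiv ℝ (h ∘ g) z).comp (ContinuousLinearMap.inr ℝ P X) := partialX_eq hGd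
    rw [h1, h2] at hue
    exact ⟨u, e, he, he', hue⟩
  have hkey : ∀ ν : StrongDual ℝ E, (∀ w ∈ K, ν w ≤ 0) →
      ν.comp ((fderiv ℝ (h ∘ g) z).comp (ContinuousLinearMap.inr ℝ P X)) = -f z →
      lagrangianDeriv (fderiv ℝ f z) (h ∘ g) z μ₀ (0, u₀) u₀ +
        2⁻¹ * (ν - μ₀) (secondDeriv (h ∘ g) z (0, u₀) (0, u₀)) ≤ 0 := fun ν hνK hν =>
    lagrangianDeriv_add_le hfd hG hGz ht ht0 hv hr hrP' hμ hμK hGK hμG hμf hνK hν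
  have hle : lagrangianDeriv (fderiv ℝ f z) (h ∘ g) z μ₀ (0, u₀) u₀ ≤ 0 := by
    simpa using hkey μ₀ hμ₀K hμ₀f
  have hmem : μ₀.comp (fderiv ℝ h (g z)) ∈ normalCone C (g z) :=
    comp_mem_normalCone_of_reduction hred hμ₀K
  have hlam₀ : f z + (μ₀.comp (fderiv ℝ h (g z))).comp (partialX g p₀ x₀) = 0 := by
    rw [hpX, ContinuousLinearMap.comp_assoc, ← ContinuousLinearMap.comp_assoc _ (fderiv ℝ g z),
      ← hchain, hμ₀f, add_neg_cancel]
  have hmax : IsMaxOn (directionalObjective g h z (0, u₀))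
      (multiplierSet g C z ((μ₀.comp (fderiv ℝ h (g z))).comp (fderiv ℝ g z)))
      (μ₀.comp (fderiv ℝ h (g z))) := by
    -- Maximality combines `hkey` for the competitor `ν` with nonnegativity at the critical
    -- direction `u₀`.
    rintro lam ⟨hlam, hlamg⟩
    obtain ⟨ν, rfl, hνK⟩ := exists_multiplier_of_mem_normalCone_reduction hred hlam
    rw [ContinuousLinearMap.comp_assoc, ContinuousLinearMap.comp_assoc, ← hchain] at hlamg
    have hν : ν.comp ((fderiv ℝ (h ∘ g) z).comp (ContinuousLinearMap.inr ℝ P X)) = -f z := by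
      rw [← hμ₀f, ← ContinuousLinearMap.comp_assoc, hlamg, ContinuousLinearMap.comp_assoc]
    have h1 := hkey ν hνK hν
    have h2 := hnonneg u₀ hucrit
    change directionalObjective g h z (0, u₀) (ν.comp (fderiv ℝ h (g z))) ≤
      directionalObjective g h z (0, u₀) (μ₀.comp (fderiv ℝ h (g z)))
    rw [directionalObjective_comp hg hh hsurj, directionalObjective_comp hg hh hsurj]
    rw [sub_apply] at h1
    linarith
  -- The same functional serves as base multiplier and as directional multiplier.
  rcases hSOC u₀ hucrit hu₀ (μ₀.comp (fderiv ℝ h (g z))) ⟨hmem, hlam₀⟩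
    (μ₀.comp (fderiv ℝ h (g z))) ⟨⟨hmem, rfl⟩, hmax⟩ with hpos | ⟨u, hu, hneg⟩
  · rw [operatorF_comp hf hg hh hsurj] at hpos
    exact hle.not_gt hpos
  · rw [operatorF_comp hf hg hh hsurj] at hneg
    exact (hnonneg u hu).not_gt hneg

end Contradiction

/-! ### Conic structure of the characteristic subspace. -/

section CharacteristicSubspace

variable {P X Y E : Type*}
  [NormedAddCommGroup P] [InnerProductSpace ℝ P]
  [NormedAddCommGroup X] [InnerProductSpace ℝ X]
  [NormedAddCommGroup E] [InnerProductSpace ℝ E]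
  {g : P × X → Y} {h : Y → E} {K : ProperCone ℝ E} {p₀ : P} {x₀ : X}

theorem zero_mem_characteristicSubspace :
    (0 : P) ∈ characteristicSubspace g h K p₀ x₀ :=
  ⟨0, 0, zero_mem K, by rw [neg_zero]; exact zero_mem K, by simp⟩

theorem smul_mem_characteristicSubspace {c : ℝ} (hc : 0 ≤ c) {q : P}
    (hq : q ∈ characteristicSubspace g h K p₀ x₀) :
    c • q ∈ characteristicSubspace g h K p₀ x₀ := by
  obtain ⟨u, e, he, he', hue⟩ := hq
  refine ⟨c • u, c • e, properCone_smul_mem K hc he, ?_, ?_⟩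
  · rw [← smul_neg]
    exact properCone_smul_mem K hc he'
  · rw [map_smul, map_smul, hue, smul_add]

end CharacteristicSubspace

/-! ### The Hölderian estimate by blow-up. -/

section Estimate

variable {P X Y E : Type*}
  [NormedAddCommGroup P] [InnerProductSpace ℝ P]
  [NormedAddCommGroup X] [InnerProductSpace ℝ X]
  [NormedAddCommGroup Y] [InnerProductSpace ℝ Y]
  [NormedAddCommGroup E] [InnerProductSpace ℝ E]
  {f : P × X → StrongDual ℝ X} {g : P × X → Y} {C : Set Y} {h : Y → E} {K : ProperCone ℝ E}
  {p₀ : P} {x₀ : X}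

/-- Uniformly bounded multipliers for the normals to nearby feasible sets. -/
theorem eventually_exists_multiplier [FiniteDimensional ℝ E] (hg : ContDiffAt ℝ 2 g (p₀, x₀))
    (hred : IsC2ConeReduction C (g (p₀, x₀)) h K) {κ : ℝ} (hκ : 0 ≤ κ)
    (hbd : ∀ᶠ z in 𝓝 (p₀, x₀), ∀ w ∈ K, ∃ x' ∈ feasibleSet g C z.1,
      ‖z.2 - x'‖ ≤ κ * ‖h (g z) - w‖) :
    ∀ᶠ z in 𝓝 (p₀, x₀), ∀ ζ ∈ normalCone (feasibleSet g C z.1) z.2,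
      h (g z) ∈ K ∧ ∃ μ : StrongDual ℝ E,
        μ.comp ((fderiv ℝ (h ∘ g) z).comp (ContinuousLinearMap.inr ℝ P X)) = ζ ∧
        (∀ w ∈ K, μ w ≤ 0) ∧ μ (h (g z)) = 0 ∧ ‖μ‖ ≤ κ * ‖ζ‖ := by
  have hG : ContDiffAt ℝ 2 (h ∘ g) (p₀, x₀) := hred.contDiffAt.comp _ hg
  have hmem : ∀ᶠ z in 𝓝 (p₀, x₀), z.2 ∈ feasibleSet g C z.1 → h (g z) ∈ K :=
    (hg.continuousAt.eventually hred.eventually_mem_iff).mono fun z hz => hz.1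
  -- Limiting normals at `z.2` involve nearby points of the slice, so the conditions are needed on a
  -- neighborhood of each `z`.
  filter_upwards [hG.eventually (by simp), hmem.eventually_nhds, hbd.eventually_nhds]
    with z hz1 hz2 hz3 ζ hζ
  have hslice : Tendsto (fun x : X => (z.1, x)) (𝓝 z.2) (𝓝 z) := by
    have : Continuous fun x : X => (z.1, x) := by fun_prop
    exact this.tendsto z.2
  have hder : ∀ᶠ x in 𝓝 z.2, HasFDerivAt (fun x => h (g (z.1, x)))
      ((fderiv ℝ (h ∘ g) (z.1, x)).comp (ContinuousLinearMap.inr ℝ P X)) x :=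
    (hslice.eventually (eventually_hasFDerivAt_of_contDiffAt (n := 2) (by simp) hz1)).mono
      fun x hx => hx.comp x (hasFDerivAt_prodMk_right z.1 x)
  have hcont : ContinuousAt (fun x : X =>
      (fderiv ℝ (h ∘ g) (z.1, x)).comp (ContinuousLinearMap.inr ℝ P X)) z.2 :=
    tendsto_clm_comp ((hasFDerivAt_fderiv_of_contDiffAt hz1).continuousAt.tendsto.comp hslice)
      tendsto_const_nhds
  exact ⟨hz2.self_of_nhds hζ.1, exists_multiplier_of_mem_normalCone hκ hder hcont
    (hslice.eventually hz2) (hslice.eventually hz3) hζ⟩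

/-- The square root in the estimate is calibrated here: the hypothesis says that the distance is
below `(t / c) ^ 2`, hence a second-order quantity in `t`. -/
theorem exists_near_characteristicSubspace (A : Set P) (hA : A.Nonempty) {p : P} {t c : ℝ}
    (ht : 0 < t) (hc : 0 < c) (h : c * √(Metric.infDist p A) < t) :
    ∃ r : P, ‖r‖ ≤ c⁻¹ ^ 2 ∧ p - t ^ 2 • r ∈ A := by
  have h1 : √(Metric.infDist p A) < c⁻¹ * t := by rwa [lt_inv_mul_iff₀ hc]
  rw [Real.sqrt_lt' (by positivity)] at h1
  obtain ⟨a, ha, hlt⟩ := (Metric.infDist_lt_iff hA).1 h1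
  have ht2 : t ^ 2 ≠ 0 := by positivity
  refine ⟨(t ^ 2)⁻¹ • (p - a), ?_, ?_⟩
  · rw [norm_smul, norm_inv, Real.norm_of_nonneg (sq_nonneg t), inv_mul_le_iff₀ (by positivity),
      ← dist_eq_norm]
    nlinarith
  · rwa [smul_smul, mul_inv_cancel₀ ht2, one_smul, sub_sub_cancel]

/-- The Hölderian estimate for solutions in a neighborhood of the reference point. -/
theorem eventually_norm_sub_le [FiniteDimensional ℝ P] [FiniteDimensional ℝ X]
    [FiniteDimensional ℝ Y] [FiniteDimensional ℝ E]
    (hf : ContDiffAt ℝ 1 f (p₀, x₀)) (hg : ContDiffAt ℝ 2 g (p₀, x₀))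
    (hred : IsC2ConeReduction C (g (p₀, x₀)) h K) (hRS : RobinsonStable g C p₀ x₀)
    (hSOC : SecondOrderCondition f g C h p₀ x₀) :
    ∃ l : ℝ, 0 < l ∧ ∀ᶠ z in 𝓝 (p₀, x₀), z.2 ∈ solutionMap f g C z.1 →
      ‖z.2 - x₀‖ ≤ l * (‖z.1 - p₀‖ +
        √(Metric.infDist (z.1 - p₀) (characteristicSubspace g h K p₀ x₀))) := by
  by_contra! hcon
  set S := characteristicSubspace g h K p₀ x₀ with hS
  have hS_ne : S.Nonempty := ⟨0, zero_mem_characteristicSubspace⟩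
  have hfd : DifferentiableAt ℝ f (p₀, x₀) := hf.differentiableAt (by simp)
  obtain ⟨κ, hκ, hbd⟩ := hRS.exists_errorBound hg.continuousAt hred
  have hmult := eventually_exists_multiplier hg hred hκ hbd
  have hproj : Tendsto (fun z : P × X => (p₀, z.2)) (𝓝 (p₀, x₀)) (𝓝 (p₀, x₀)) := by
    have : Continuous fun z : P × X => (p₀, z.2) := by fun_prop
    exact this.tendsto (p₀, x₀)
  have hfb : ∀ᶠ z in 𝓝 (p₀, x₀), ‖f z‖ < ‖f (p₀, x₀)‖ + 1 :=
    hf.continuousAt.norm.eventually_lt_const (by linarith)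
  have hpos : ∀ k : ℕ, (0 : ℝ) < k + 1 := fun k => by positivity
  have hex : ∀ k : ℕ, ∃ z : P × X, dist z (p₀, x₀) < 1 / ((k : ℝ) + 1) ∧
      z.2 ∈ solutionMap f g C z.1 ∧
      ((k : ℝ) + 1) * (‖z.1 - p₀‖ + √(Metric.infDist (z.1 - p₀) S)) < ‖z.2 - x₀‖ ∧
      (∀ ζ ∈ normalCone (feasibleSet g C z.1) z.2,
        h (g z) ∈ K ∧ ∃ μ : StrongDual ℝ E,
          μ.comp ((fderiv ℝ (h ∘ g) z).comp (ContinuousLinearMap.inr ℝ P X)) = ζ ∧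
          (∀ w ∈ K, μ w ≤ 0) ∧ μ (h (g z)) = 0 ∧ ‖μ‖ ≤ κ * ‖ζ‖) ∧
      -- The error bound at the unperturbed parameter is what later makes the limit direction
      -- tangent to the reference feasible set.
      (∀ w ∈ K, ∃ x' ∈ feasibleSet g C p₀, ‖z.2 - x'‖ ≤ κ * ‖h (g (p₀, z.2)) - w‖) ∧
      ‖f z‖ < ‖f (p₀, x₀)‖ + 1 := by
    intro k
    have hball : ∀ᶠ z in 𝓝 (p₀, x₀), dist z (p₀, x₀) < 1 / ((k : ℝ) + 1) :=
      Metric.ball_mem_nhds _ (one_div_pos.2 (hpos k))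
    obtain ⟨z, ⟨h1, h2⟩, h3, h4, h5, h6⟩ := ((hcon _ (hpos k)).and_eventually
      (hball.and (hmult.and ((hproj.eventually hbd).and hfb)))).exists
    exact ⟨z, h3, h1, h2, h4, h5, h6⟩
  choose z hz hsol hlarge hzmult hzbd hzf using hex
  have hzlim : Tendsto z atTop (𝓝 (p₀, x₀)) := by
    rw [tendsto_iff_dist_tendsto_zero]
    exact squeeze_zero (fun _ => dist_nonneg) (fun k => (hz k).le)
      tendsto_one_div_add_atTop_nhds_zero_nat
  set t : ℕ → ℝ := fun k => ‖(z k).2 - x₀‖ with htdef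
  have ht : ∀ k, 0 < t k := fun k =>
    (mul_nonneg (hpos k).le (add_nonneg (norm_nonneg _) (Real.sqrt_nonneg _))).trans_lt (hlarge k)
  have ht0 : Tendsto t atTop (𝓝 0) := by
    have h1 := ((continuous_snd.tendsto _).comp hzlim).sub_const x₀
    simpa using h1.norm
  have hlp : ∀ k : ℕ, ((k : ℝ) + 1) * ‖(z k).1 - p₀‖ < t k := fun k => by
    have h1 := hlarge k
    rw [mul_add] at h1
    have h2 := mul_nonneg (hpos k).le (Real.sqrt_nonneg (Metric.infDist ((z k).1 - p₀) S))
    linarith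
  have hlr : ∀ k : ℕ, ((k : ℝ) + 1) * √(Metric.infDist ((z k).1 - p₀) S) < t k := fun k => by
    have h1 := hlarge k
    rw [mul_add] at h1
    have h2 := mul_nonneg (hpos k).le (norm_nonneg ((z k).1 - p₀))
    linarith
  choose r hr hrP using fun k =>
    exists_near_characteristicSubspace S hS_ne (ht k) (hpos k) (hlr k)
  choose hzK μ hμf hμK hμG hμn using fun k => hzmult k _ (hsol k)
  have hone : Tendsto (fun k : ℕ => ((k : ℝ) + 1)⁻¹) atTop (𝓝 0) := by
    simpa using tendsto_one_div_add_atTop_nhds_zero_nat (𝕜 := ℝ)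
  have hr0 : Tendsto r atTop (𝓝 0) :=
    squeeze_zero_norm hr (by simpa using hone.pow 2)
  have hq0 : Tendsto (fun k => (t k)⁻¹ • ((z k).1 - p₀)) atTop (𝓝 0) := by
    refine squeeze_zero_norm (fun k => ?_) hone
    have := ht k
    rw [norm_smul, norm_inv, Real.norm_of_nonneg this.le, inv_mul_le_iff₀ this,
      ← div_eq_mul_inv, le_div_iff₀ (hpos k), mul_comm]
    exact (hlp k).le
  have : ProperSpace X := FiniteDimensional.proper_real X
  have : ProperSpace (StrongDual ℝ E) := FiniteDimensional.proper_real _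
  have hcomp := (isCompact_sphere (0 : X) 1).prod
    (isCompact_closedBall (0 : StrongDual ℝ E) (κ * (‖f (p₀, x₀)‖ + 1)))
  have hin : ∀ k, ((t k)⁻¹ • ((z k).2 - x₀), μ k) ∈ Metric.sphere (0 : X) 1 ×ˢ
      Metric.closedBall (0 : StrongDual ℝ E) (κ * (‖f (p₀, x₀)‖ + 1)) := fun k => by
    refine ⟨?_, ?_⟩
    · rw [mem_sphere_zero_iff_norm, norm_smul, norm_inv, Real.norm_of_nonneg (ht k).le]
      exact inv_mul_cancel₀ (ht k).ne'
    · rw [mem_closedBall_zero_iff]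
      refine (hμn k).trans (mul_le_mul_of_nonneg_left ?_ hκ)
      rw [norm_neg]
      exact (hzf k).le
  obtain ⟨⟨u₀, μ₀⟩, ⟨hu₀, -⟩, φ, hφ, hlim⟩ := hcomp.tendsto_subseq hin
  have hulim : Tendsto (fun k => (t (φ k))⁻¹ • ((z (φ k)).2 - x₀)) atTop (𝓝 u₀) :=
    (continuous_fst.tendsto _).comp hlim
  have hμlim : Tendsto (fun k => μ (φ k)) atTop (𝓝 μ₀) := (continuous_snd.tendsto _).comp hlim
  have hu₀ne : u₀ ≠ 0 := by
    rintro rfl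
    simp at hu₀
  have hzv : ∀ k, (p₀, x₀) + t k • ((t k)⁻¹ • (z k - (p₀, x₀))) = z k := fun k => by
    rw [smul_smul, mul_inv_cancel₀ (ht k).ne', one_smul, add_sub_cancel]
  have hzv2 : ∀ k, x₀ + t k • ((t k)⁻¹ • (z k - (p₀, x₀))).2 = (z k).2 := fun k =>
    congrArg Prod.snd (hzv k)
  refine hSOC.false_of_tendsto (κ := κ) (t := fun k => t (φ k))
    (v := fun k => (t (φ k))⁻¹ • (z (φ k) - (p₀, x₀))) (r := fun k => r (φ k))
    (μ := fun k => μ (φ k)) hfd hg hred hu₀ne (fun k => ht _) (ht0.comp hφ.tendsto_atTop)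
    ((hq0.comp hφ.tendsto_atTop).prodMk_nhds hulim) (hr0.comp hφ.tendsto_atTop) (fun k => ?_)
    hμlim (fun k => hμK _) (fun k => ?_) (fun k => ?_) (fun k => ?_) (fun k => ?_)
  · have h1 := smul_mem_characteristicSubspace (inv_pos.2 (ht (φ k))).le (hrP (φ k))
    have h2 : (t (φ k))⁻¹ • ((z (φ k)).1 - p₀ - t (φ k) ^ 2 • r (φ k)) =
        (t (φ k))⁻¹ • ((z (φ k)).1 - p₀) - t (φ k) • r (φ k) := by
      rw [smul_sub, smul_smul, pow_two, inv_mul_cancel_left₀ (ht (φ k)).ne']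
    rw [h2] at h1
    exact h1
  · rw [hzv]; exact hzK _
  · rw [hzv]; exact hμG _
  · rw [hzv]; exact hμf _
  · rw [hzv, hzv2]
    exact hzbd _ _ (hzK _)

end Estimate

end PVS

/-! ### From the estimate to isolated calmness. -/

theorem mainTheorem8 {P X Y E : Type*}
    [NormedAddCommGroup P] [InnerProductSpace ℝ P] [FiniteDimensional ℝ P]
    [NormedAddCommGroup X] [InnerProductSpace ℝ X] [FiniteDimensional ℝ X]
    [NormedAddCommGroup Y] [InnerProductSpace ℝ Y] [FiniteDimensional ℝ Y]
    [NormedAddCommGroup E] [InnerProductSpace ℝ E] [FiniteDimensional ℝ E]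
    (f : P × X → StrongDual ℝ X) (g : P × X → Y) (C : Set Y) (h : Y → E) (K : ProperCone ℝ E)
    (p₀ : P) (x₀ : X)
    (hf : ContDiffAt ℝ 1 f (p₀, x₀))
    (hg : ContDiffAt ℝ 2 g (p₀, x₀))
    (hC : IsClosed C)
    (hred : PVS.IsC2ConeReduction C (g (p₀, x₀)) h K)
    (hsol : x₀ ∈ PVS.solutionMap f g C p₀)
    (hRS : PVS.RobinsonStable g C p₀ x₀)
    (hSOC : PVS.SecondOrderCondition f g C h p₀ x₀) :
    (∃ l : ℝ, 0 < l ∧ ∃ U ∈ 𝓝 x₀, ∃ Q ∈ 𝓝 p₀,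
      (∀ p ∈ Q, PVS.solutionMap f g C p ∩ U ⊆ Metric.closedBall x₀
        (l * (‖p - p₀‖ +
          √(Metric.infDist (p - p₀) (PVS.characteristicSubspace g h K p₀ x₀))))) ∧
      ∀ γ : ℝ, 0 < γ →
        ∀ p ∈ Q ∩ PVS.nearSubspace (PVS.characteristicSubspace g h K p₀ x₀) p₀ γ,
          PVS.solutionMap f g C p ∩ U ⊆ Metric.closedBall x₀ ((l + γ) * ‖p - p₀‖)) ∧
    ∀ γ : ℝ, 0 < γ →
      PVS.IsolatedlyCalmOn (PVS.solutionMap f g C)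
        (PVS.nearSubspace (PVS.characteristicSubspace g h K p₀ x₀) p₀ γ) p₀ x₀ := by
  obtain ⟨l, hl, hev⟩ := PVS.eventually_norm_sub_le hf hg hred hRS hSOC
  set S := PVS.characteristicSubspace g h K p₀ x₀ with hS
  obtain ⟨Q, hQ, U, hU, hQU⟩ := mem_nhds_prod_iff.1 hev
  have hest : ∀ p ∈ Q, ∀ x ∈ PVS.solutionMap f g C p ∩ U,
      ‖x - x₀‖ ≤ l * (‖p - p₀‖ + √(Metric.infDist (p - p₀) S)) := fun p hp x hx =>
    hQU (mk_mem_prod hp hx.2) hx.1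
  have hγest : ∀ γ : ℝ, 0 < γ → ∀ p ∈ Q ∩ PVS.nearSubspace S p₀ γ,
      PVS.solutionMap f g C p ∩ U ⊆
        Metric.closedBall x₀ ((l + l ^ 2 + γ) * ‖p - p₀‖) := by
    intro γ hγ p hp x hx
    rw [mem_closedBall_iff_norm]
    have h1 : √(Metric.infDist (p - p₀) S) ≤ √γ * ‖p - p₀‖ := by
      rw [← Real.sqrt_sq (norm_nonneg (p - p₀)), ← Real.sqrt_mul hγ.le]
      exact Real.sqrt_le_sqrt hp.2
    -- This bound makes the constant additive in `γ`. Enlarging `l` to `l + l ^ 2` gives one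
    -- constant, with fixed neighborhoods, valid for every `γ`.
    have h2 : l * √γ ≤ l ^ 2 + γ := by
      nlinarith [sq_nonneg (l - √γ), Real.sq_sqrt hγ.le, sq_nonneg l]
    calc ‖x - x₀‖ ≤ l * (‖p - p₀‖ + √(Metric.infDist (p - p₀) S)) := hest p hp.1 x hx
      _ ≤ l * (‖p - p₀‖ + √γ * ‖p - p₀‖) := by gcongr
      _ = (l + l * √γ) * ‖p - p₀‖ := by ring
      _ ≤ (l + (l ^ 2 + γ)) * ‖p - p₀‖ := by gcongr
      _ = (l + l ^ 2 + γ) * ‖p - p₀‖ := by ring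
  refine ⟨⟨l + l ^ 2, by positivity, U, hU, Q, hQ, fun p hp x hx => ?_, hγest⟩,
    fun γ hγ => ⟨l + l ^ 2 + γ, by positivity, Q, hQ, U, hU, hγest γ hγ⟩⟩
  rw [mem_closedBall_iff_norm]
  refine (hest p hp x hx).trans (mul_le_mul_of_nonneg_right ?_ (by positivity))
  nlinarith [sq_nonneg l]
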